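/- **Setting.** The *enriched effect calculus* (EEC) of Egger, Møgelberg and Simpson has value types $A$ and computation types $\underline A$, built from a set of value type constants $\alpha$ and a disjoint set of computation type constants $\underline\alpha$: $$A ::= \alpha \mid 1 \mid A\times B \mid A\to B \mid \underline A \mid \underline A\multimap\underline B,$$ $$\underline A ::= \underline\alpha \mid \underline 1 \mid \underline A\,\&\,\underline B \mid A\Rightarrow\underline B \mid \underline I \mid\; !A \mid\; !A\otimes\underline B \mid \underline 0 \mid \underline A\oplus\underline B .$$ Judgements are $\Gamma\mid - \vdash t:A$ (empty stoup) and $\Gamma\mid z:\underline A\vdash t:\underline B$ (stoup with one linear variable). With $\Delta$ an arbitrary stoup, the terms are * with empty stoup: variables $x$; ${*}:1$; $\langle t,u\rangle:A\times B$, $\mathrm{fst}\,t$, $\mathrm{snd}\,t$; $\lambda x{:}A.t:A\to B$, $s(t)$; $\top:\underline I$; $!t:{!A}$ for $\Gamma\mid-\vdash t:A$; and $\underline\lambda z{:}\underline A.t:\underline A\multimap\underline B$ for $\Gamma\mid z:\underline A\vdash t:\underline B$; * the stoup variable $\Gamma\mid z:\underline A\vdash z:\underline A$; * with stoup $\Delta$: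 $\underline{*}:\underline 1$; $\langle t,u\rangle:\underline A\,\&\,\underline B$, $\mathrm{fst}\,t$, $\mathrm{snd}\,t$; $\lambda x{:}A.t:A\Rightarrow\underline B$, $s(t)$ with $\Gamma\mid-\vdash t:A$; $\mathrm{let}\ \top\ \mathrm{be}\ t\ \mathrm{in}\ u$ with $\Gamma\mid\Delta\vdash t:\underline I$, $\Gamma\mid-\vdash u:\underline A$; $\mathrm{let}\ !x\ \mathrm{be}\ t\ \mathrm{in}\ u$ with $\Gamma\mid\Delta\vdash t:{!A}$, $\Gamma,x{:}A\mid-\vdash u:\underline B$; $!t\otimes u:{!A\otimes\underline B}$ with $\Gamma\mid-\vdash t:A$, $\Gamma\mid\Delta\vdash u:\underline B$; $\mathrm{let}\ !x\otimes y\ \mathrm{be}\ s\ \mathrm{in}\ t$ with $\Gamma\mid\Delta\vdash s:{!A\otimes\underline B}$, $\Gamma,x{:}A\mid y:\underline B\vdash t:\underline C$; $?(t):\underline A$ for $t:\underline 0$; $\mathrm{inl}\,t$, $\mathrm{inr}\,t$; $\mathrm{case}\ s\ \mathrm{of}\ (\mathrm{inl}\,x.\,t;\ \mathrm{inr}\,y.\,u)$,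 where $x$, $y$ are the stoup variables of $t$, $u$; $s[t]:\underline B$ with $\Gamma\mid-\vdash s:\underline A\multimap\underline B$, $\Gamma\mid\Delta\vdash t:\underline A$. Equality $\Gamma\mid\Delta\vdash t=u:A$ is the least typed congruence (modulo $\alpha$-equivalence) containing the $\beta$- and $\eta$-equalities of all type constructors. For $\underline I$, $!A$, $!A\otimes\underline B$, $\underline 0$, $\underline A\oplus\underline B$ the $\eta$-equalities are, for $u$ with stoup variable $w$ of the type in question: $\mathrm{let}\ \top\ \mathrm{be}\ t\ \mathrm{in}\ u[\top/w]=u[t/w]$, $\mathrm{let}\ !x\ \mathrm{be}\ t\ \mathrm{in}\ u[!x/w]=u[t/w]$, $\mathrm{let}\ !x\otimes y\ \mathrm{be}\ t\ \mathrm{in}\ u[!x\otimes y/w]=u[t/w]$, $?(t)=u[t/w]$, $\mathrm{case}\ t\ \mathrm{of}\ (\mathrm{inl}\,x.\,u[\mathrm{inl}\,x/w];\ \mathrm{inr}\,y.\,u[\mathrm{inr}\,y/w])=u[t/w]$. **The self-translation.** Fix a computation type $\underline R$. For value types, $\alpha^\circ=\alpha$, $1^\circ=1$, $(A\times B)^\circ=A^\circ\times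 B^\circ$, $(A\to B)^\circ=A^\circ\to B^\circ$, $(\underline A\multimap\underline B)^\circ=\underline B^\bullet\multimap\underline A^\bullet$, and $\underline A^\circ=\underline A^\bullet\multimap\underline R$ for a computation type regarded as a value type. For computation types, $\underline\alpha^\bullet=\underline I$ if $\underline\alpha=\underline R$ and $\underline\alpha^\bullet=\underline\alpha$ otherwise, $\underline 1^\bullet=\underline 0$, $(\underline A\,\&\,\underline B)^\bullet=\underline A^\bullet\oplus\underline B^\bullet$, $(A\Rightarrow\underline B)^\bullet={!A^\circ\otimes\underline B^\bullet}$, $\underline I^\bullet=\underline R$, $(!A)^\bullet=A^\circ\Rightarrow\underline R$, $(!A\otimes\underline B)^\bullet=A^\circ\Rightarrow\underline B^\bullet$, $\underline 0^\bullet=\underline 1$, $(\underline A\oplus\underline B)^\bullet=\underline A^\bullet\,\&\,\underline B^\bullet$. A term $\Gamma\mid-\vdash t:A$ is translated to $\Gamma^\circ\mid-\vdash t^\circ:A^\circ$, and a term $\Gamma\mid z:\underline A\vdash t:\underline B$ to $\Gamma^\circ\mid k:\underline B^\bullet\vdash t^\bullet:\underline A^\bullet$. Below, $k$ always denotes the stoup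 variable of a translated term, and $t^\bullet[v]$ is $t^\bullet[v/k]$. * Nonempty stoup: $z^\bullet=k$; $\underline{*}^\bullet={?(k)}$; $\langle t,u\rangle^\bullet=\mathrm{case}\ k\ \mathrm{of}\ (\mathrm{inl}\,k.\,t^\bullet;\ \mathrm{inr}\,k.\,u^\bullet)$; $(\mathrm{fst}\,t)^\bullet=t^\bullet[\mathrm{inl}\,k]$; $(\mathrm{snd}\,t)^\bullet=t^\bullet[\mathrm{inr}\,k]$; $(\lambda x{:}A.t)^\bullet=\mathrm{let}\ !x\otimes k\ \mathrm{be}\ k\ \mathrm{in}\ t^\bullet$; $(s(t))^\bullet=s^\bullet[!t^\circ\otimes k]$; $(\mathrm{let}\ \top\ \mathrm{be}\ t\ \mathrm{in}\ u)^\bullet=t^\bullet[u^\circ[k]]$; $(\mathrm{let}\ !x\ \mathrm{be}\ t\ \mathrm{in}\ u)^\bullet=t^\bullet[\lambda x{:}A^\circ.\,u^\circ[k]]$; $(!t\otimes u)^\bullet=u^\bullet[k(t^\circ)]$; $(\mathrm{let}\ !x\otimes y\ \mathrm{be}\ s\ \mathrm{in}\ t)^\bullet=s^\bullet[\lambda x{:}A^\circ.\,t^\bullet]$;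 $(?(t))^\bullet=t^\bullet[\underline{*}]$; $(\mathrm{inl}\,t)^\bullet=t^\bullet[\mathrm{fst}\,k]$; $(\mathrm{inr}\,t)^\bullet=t^\bullet[\mathrm{snd}\,k]$; $(\mathrm{case}\ s\ \mathrm{of}\ (\mathrm{inl}\,x.\,t;\ \mathrm{inr}\,y.\,u))^\bullet=s^\bullet[\langle t^\bullet,u^\bullet\rangle]$; $(s[t])^\bullet=t^\bullet[s^\circ[k]]$. * Empty stoup: $(-)^\circ$ commutes with variables, $*$, and with pairing, projections, $\lambda$ and application of the value types $\times$ and $\to$. Moreover $\top^\circ=\underline\lambda k.\,k$, $(!t)^\circ=\underline\lambda k.\,k(t^\circ)$, $(\underline\lambda z{:}\underline A.t)^\circ=\underline\lambda k.\,t^\bullet$; $\underline{*}^\circ=\underline\lambda k.\,?(k)$; $\langle t,u\rangle^\circ=\underline\lambda k.\,\mathrm{case}\ k\ \mathrm{of}\ (\mathrm{inl}\,k.\,t^\circ[k];\ \mathrm{inr}\,k.\,u^\circ[k])$ for $\&$; $(\lambda x{:}A.t)^\circ=\underline\lambda k.\,\mathrm{let}\ !x\otimes h\ \mathrm{be}\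 k\ \mathrm{in}\ t^\circ[h]$ for $\Rightarrow$. Each remaining term former with empty stoup is translated as $\underline\lambda k.\,p^\circ[v]$, where $p^\bullet[v]$ is the clause displayed above for the same term former (for example $(s[t])^\circ=\underline\lambda k.\,t^\circ[s^\circ[k]]$). **The isomorphisms.** Suppose that $\underline R$ is a computation type constant or $\underline I$, so that $\underline R^\bullet=\underline I$. Define closed terms $\vartheta_A:A^{\circ\circ}\to A$ and $\underline\vartheta_{\underline A}:\underline A^{\bullet\bullet}\multimap\underline A$, together with $\vartheta_A^{-1}:A\to A^{\circ\circ}$ and $\underline\vartheta_{\underline A}^{-1}:\underline A\multimap\underline A^{\bullet\bullet}$, by simultaneous recursion on types: $\vartheta_\alpha=\lambda x.x$; $\vartheta_1=\lambda x.{*}$; $\vartheta_{A\times B}=\lambda z.\langle\vartheta_A(\mathrm{fst}\,z),\vartheta_B(\mathrm{snd}\,z)\rangle$; $\vartheta_{A\to B}=\lambda f.\lambda x.\,\vartheta_B(f(\vartheta_A^{-1}(x)))$; $\vartheta_{\underline A}=\lambda h{:}\underline I\multimap\underline A^{\bullet\bullet}.\,\underline\vartheta_{\underline A}[h[\top]]$;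 $\vartheta_{\underline A\multimap\underline B}=\lambda h.\underline\lambda x.\,\underline\vartheta_{\underline B}[h[\underline\vartheta_{\underline A}^{-1}[x]]]$; $\underline\vartheta_{\underline\alpha}$, $\underline\vartheta_{\underline I}$, $\underline\vartheta_{\underline 0}$ are $\underline\lambda z.z$; $\underline\vartheta_{\underline 1}=\underline\lambda z.\underline{*}$; $\underline\vartheta_{\underline A\&\underline B}=\underline\lambda z.\langle\underline\vartheta_{\underline A}[\mathrm{fst}\,z],\underline\vartheta_{\underline B}[\mathrm{snd}\,z]\rangle$; $\underline\vartheta_{A\Rightarrow\underline B}=\underline\lambda f.\lambda x{:}A.\,\underline\vartheta_{\underline B}[f(\vartheta_A^{-1}(x))]$; $\underline\vartheta_{!A}=\underline\lambda z.\,\mathrm{let}\ !x\otimes y\ \mathrm{be}\ z\ \mathrm{in}\ \mathrm{let}\ \top\ \mathrm{be}\ y\ \mathrm{in}\ !(\vartheta_A(x))$; $\underline\vartheta_{!A\otimes\underline B}=\underline\lambda z.\,\mathrm{let}\ !x\otimes y\ \mathrm{be}\ z\ \mathrm{in}\ !(\vartheta_A(x))\otimes\underline\vartheta_{\underline B}[y]$;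 $\underline\vartheta_{\underline A\oplus\underline B}=\underline\lambda z.\,\mathrm{case}\ z\ \mathrm{of}\ (\mathrm{inl}\,x.\,\mathrm{inl}(\underline\vartheta_{\underline A}[x]);\ \mathrm{inr}\,y.\,\mathrm{inr}(\underline\vartheta_{\underline B}[y]))$. The inverses are given by the same clauses with $\vartheta$, $\underline\vartheta$ and $\vartheta^{-1}$, $\underline\vartheta^{-1}$ exchanged, except that $\vartheta_{\underline A}^{-1}=\lambda x.\underline\lambda z{:}\underline I.\,\mathrm{let}\ \top\ \mathrm{be}\ z\ \mathrm{in}\ \underline\vartheta_{\underline A}^{-1}[x]$ and $\underline\vartheta_{!A}^{-1}=\underline\lambda w.\,\mathrm{let}\ !x\ \mathrm{be}\ w\ \mathrm{in}\ !(\vartheta_A^{-1}(x))\otimes\top$. For $\Gamma=x_1{:}C_1,\dots,x_n{:}C_n$ let $[\vartheta^{-1}\Gamma]$ be the substitution $[\vartheta_{C_1}^{-1}(x_1),\dots,\vartheta_{C_n}^{-1}(x_n)/x_1,\dots,x_n]$. **Theorem (Involution property).** Suppose that $\underline R$ is a computation type constant or $\underline I$. Then, in the equational theory of EEC, each $\vartheta_A$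 is an isomorphism with inverse $\vartheta_A^{-1}$, each $\underline\vartheta_{\underline A}$ is a linear isomorphism with inverse $\underline\vartheta_{\underline A}^{-1}$, and 1. if $\Gamma\mid-\vdash t:A$, then $\Gamma\mid-\vdash t=\vartheta_A(t^{\circ\circ})[\vartheta^{-1}\Gamma]:A$; 2. if $\Gamma\mid z:\underline A\vdash t:\underline B$, then $\Gamma\mid z:\underline A\vdash t=\underline\vartheta_{\underline B}\big[\,t^{\bullet\bullet}[\underline\vartheta_{\underline A}^{-1}[z]/k]\,\big][\vartheta^{-1}\Gamma]:\underline B$, where $k$ is the stoup variable of $t^{\bullet\bullet}$. -/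

import Mathlib

/-!
# The enriched effect calculus (EEC) and its generic linear-use CPS self-translation

Terms are intrinsically typed and use de Bruijn indices, so that `α`-equivalent terms are
identical.  `V` is the set of value type constants, `W` the set of computation type constants.
-/

namespace EEC

universe u v

/-! ## Types -/

mutual
/-- Value types; `comp` is the (invisible) inclusion of computation types in value types,
`lolli A B` is the linear function type `A ⊸ B`. -/
inductive VTy (V : Type u) (W : Type v) : Type (max u v)
  | const : V → VTy V W
  | one : VTy V W
  | prod : VTy V W → VTy V W → VTy V W
  | arr : VTy V W → VTy V W → VTy V W
  | comp : CTy V W → VTy V W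
  | lolli : CTy V W → CTy V W → VTy V W

/-- Computation types: constants, `1`, `A & B`, `A ⇒ B`, `I`, `!A`, the copower `!A ⊗ B`
(a single binary constructor), `0` and `A ⊕ B`. -/
inductive CTy (V : Type u) (W : Type v) : Type (max u v)
  | const : W → CTy V W
  | one : CTy V W
  | amp : CTy V W → CTy V W → CTy V W
  | pow : VTy V W → CTy V W → CTy V W
  | I : CTy V W
  | bang : VTy V W → CTy V W
  | copow : VTy V W → CTy V W → CTy V W
  | zero : CTy V W
  | plus : CTy V W → CTy V W → CTy V W
end

/-- Contexts; the most recent variable is the head of the list. -/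
abbrev Ctx (V : Type u) (W : Type v) := List (VTy V W)

/-- A stoup is empty or holds a single computation type. -/
abbrev Stoup (V : Type u) (W : Type v) := Option (CTy V W)

variable {V : Type u} {W : Type v}

/-- The variables of type `A` in a context. -/
inductive Var : Ctx V W → VTy V W → Type (max u v)
  | zero {Γ : Ctx V W} {A : VTy V W} : Var (A :: Γ) A
  | succ {Γ : Ctx V W} {A B : VTy V W} : Var Γ A → Var (B :: Γ) A

/-! ## Terms -/

/-- `Tm Γ Δ A` is the type of terms `t` with `Γ | Δ ⊢ t : A`.  If the stoup `Δ` is not empty,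
then every rule forces `A` to be a computation type. -/
inductive Tm : Ctx V W → Stoup V W → VTy V W → Type (max u v)
  | var {Γ : Ctx V W} {A : VTy V W} : Var Γ A → Tm Γ none A
  | star {Γ : Ctx V W} : Tm Γ none .one
  | pair {Γ : Ctx V W} {A B : VTy V W} :
      Tm Γ none A → Tm Γ none B → Tm Γ none (.prod A B)
  | fst {Γ : Ctx V W} {A B : VTy V W} : Tm Γ none (.prod A B) → Tm Γ none A
  | snd {Γ : Ctx V W} {A B : VTy V W} : Tm Γ none (.prod A B) → Tm Γ none B
  | lam {Γ : Ctx V W} {A B : VTy V W} : Tm (A :: Γ) none B → Tm Γ none (.arr A B)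
  | app {Γ : Ctx V W} {A B : VTy V W} :
      Tm Γ none (.arr A B) → Tm Γ none A → Tm Γ none B
  /-- the variable in the stoup -/
  | svar {Γ : Ctx V W} {A : CTy V W} : Tm Γ (some A) (.comp A)
  | cstar {Γ : Ctx V W} {Δ : Stoup V W} : Tm Γ Δ (.comp .one)
  | cpair {Γ : Ctx V W} {Δ : Stoup V W} {A B : CTy V W} :
      Tm Γ Δ (.comp A) → Tm Γ Δ (.comp B) → Tm Γ Δ (.comp (.amp A B))
  | cfst {Γ : Ctx V W} {Δ : Stoup V W} {A B : CTy V W} :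
      Tm Γ Δ (.comp (.amp A B)) → Tm Γ Δ (.comp A)
  | csnd {Γ : Ctx V W} {Δ : Stoup V W} {A B : CTy V W} :
      Tm Γ Δ (.comp (.amp A B)) → Tm Γ Δ (.comp B)
  | clam {Γ : Ctx V W} {Δ : Stoup V W} {A : VTy V W} {B : CTy V W} :
      Tm (A :: Γ) Δ (.comp B) → Tm Γ Δ (.comp (.pow A B))
  | capp {Γ : Ctx V W} {Δ : Stoup V W} {A : VTy V W} {B : CTy V W} :
      Tm Γ Δ (.comp (.pow A B)) → Tm Γ none A → Tm Γ Δ (.comp B)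
  | top {Γ : Ctx V W} : Tm Γ none (.comp .I)
  /-- `let ⊤ be t in u` -/
  | ilet {Γ : Ctx V W} {Δ : Stoup V W} {A : CTy V W} :
      Tm Γ Δ (.comp .I) → Tm Γ none (.comp A) → Tm Γ Δ (.comp A)
  | bang {Γ : Ctx V W} {A : VTy V W} : Tm Γ none A → Tm Γ none (.comp (.bang A))
  /-- `let !x be t in u` -/
  | blet {Γ : Ctx V W} {Δ : Stoup V W} {A : VTy V W} {B : CTy V W} :
      Tm Γ Δ (.comp (.bang A)) → Tm (A :: Γ) none (.comp B) → Tm Γ Δ (.comp B)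
  /-- `!t ⊗ u` -/
  | ten {Γ : Ctx V W} {Δ : Stoup V W} {A : VTy V W} {B : CTy V W} :
      Tm Γ none A → Tm Γ Δ (.comp B) → Tm Γ Δ (.comp (.copow A B))
  /-- `let !x ⊗ y be s in t` -/
  | tlet {Γ : Ctx V W} {Δ : Stoup V W} {A : VTy V W} {B C : CTy V W} :
      Tm Γ Δ (.comp (.copow A B)) → Tm (A :: Γ) (some B) (.comp C) → Tm Γ Δ (.comp C)
  /-- `?(t)`, elimination of the type `0` -/
  | image {Γ : Ctx V W} {Δ : Stoup V W} {A : CTy V W} :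
      Tm Γ Δ (.comp .zero) → Tm Γ Δ (.comp A)
  | inl {Γ : Ctx V W} {Δ : Stoup V W} {A B : CTy V W} :
      Tm Γ Δ (.comp A) → Tm Γ Δ (.comp (.plus A B))
  | inr {Γ : Ctx V W} {Δ : Stoup V W} {A B : CTy V W} :
      Tm Γ Δ (.comp B) → Tm Γ Δ (.comp (.plus A B))
  | cases {Γ : Ctx V W} {Δ : Stoup V W} {A B C : CTy V W} :
      Tm Γ Δ (.comp (.plus A B)) → Tm Γ (some A) (.comp C) → Tm Γ (some B) (.comp C) →
        Tm Γ Δ (.comp C)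
  /-- linear abstraction of the variable in the stoup -/
  | llam {Γ : Ctx V W} {A B : CTy V W} : Tm Γ (some A) (.comp B) → Tm Γ none (.lolli A B)
  | lapp {Γ : Ctx V W} {Δ : Stoup V W} {A B : CTy V W} :
      Tm Γ none (.lolli A B) → Tm Γ Δ (.comp A) → Tm Γ Δ (.comp B)

/-! ## Renaming and substitution -/

/-- Renamings from `Γ` to `Γ'`. -/
abbrev Ren (Γ Γ' : Ctx V W) := ∀ A : VTy V W, Var Γ A → Var Γ' A

def Ren.lift {Γ Γ' : Ctx V W} (ρ : Ren Γ Γ') (B : VTy V W) : Ren (B :: Γ) (B :: Γ')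
  | _, .zero => .zero
  | _, .succ x => .succ (ρ _ x)

def Tm.ren {Γ Γ' : Ctx V W} {Δ : Stoup V W} {A : VTy V W} :
    Tm Γ Δ A → Ren Γ Γ' → Tm Γ' Δ A
  | .var x, ρ => .var (ρ _ x)
  | .star, _ => .star
  | .pair t u, ρ => .pair (t.ren ρ) (u.ren ρ)
  | .fst t, ρ => .fst (t.ren ρ)
  | .snd t, ρ => .snd (t.ren ρ)
  | .lam t, ρ => .lam (t.ren (ρ.lift _))
  | .app t u, ρ => .app (t.ren ρ) (u.ren ρ)
  | .svar, _ => .svar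
  | .cstar, _ => .cstar
  | .cpair t u, ρ => .cpair (t.ren ρ) (u.ren ρ)
  | .cfst t, ρ => .cfst (t.ren ρ)
  | .csnd t, ρ => .csnd (t.ren ρ)
  | .clam t, ρ => .clam (t.ren (ρ.lift _))
  | .capp t u, ρ => .capp (t.ren ρ) (u.ren ρ)
  | .top, _ => .top
  | .ilet t u, ρ => .ilet (t.ren ρ) (u.ren ρ)
  | .bang t, ρ => .bang (t.ren ρ)
  | .blet t u, ρ => .blet (t.ren ρ) (u.ren (ρ.lift _))
  | .ten t u, ρ => .ten (t.ren ρ) (u.ren ρ)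
  | .tlet s t, ρ => .tlet (s.ren ρ) (t.ren (ρ.lift _))
  | .image t, ρ => .image (t.ren ρ)
  | .inl t, ρ => .inl (t.ren ρ)
  | .inr t, ρ => .inr (t.ren ρ)
  | .cases s t u, ρ => .cases (s.ren ρ) (t.ren ρ) (u.ren ρ)
  | .llam t, ρ => .llam (t.ren ρ)
  | .lapp s t, ρ => .lapp (s.ren ρ) (t.ren ρ)

/-- Weakening by one variable. -/
def Tm.wk {Γ : Ctx V W} {Δ : Stoup V W} {A : VTy V W} (B : VTy V W) (t : Tm Γ Δ A) :
    Tm (B :: Γ) Δ A :=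
  t.ren fun _ x => .succ x

/-- A closed term, considered in an arbitrary context. -/
def Tm.closed {A : VTy V W} (Γ : Ctx V W) (t : Tm ([] : Ctx V W) none A) : Tm Γ none A :=
  t.ren fun _ x => nomatch x

/-- Simultaneous substitutions for the variables of the context `Γ`. -/
abbrev VSub (Γ Γ' : Ctx V W) := ∀ A : VTy V W, Var Γ A → Tm Γ' none A

def VSub.lift {Γ Γ' : Ctx V W} (σ : VSub Γ Γ') (B : VTy V W) : VSub (B :: Γ) (B :: Γ')
  | _, .zero => .var .zero
  | _, .succ x => (σ _ x).wk B

/-- Substitutions for the stoup: nothing is substituted for an empty stoup, and a term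
`Γ' | Δ' ⊢ u : D` is substituted for the variable of a stoup that holds `D`. -/
inductive SSub (Γ' : Ctx V W) : Stoup V W → Stoup V W → Type (max u v)
  | empty : SSub Γ' none none
  | term {D : CTy V W} {Δ' : Stoup V W} : Tm Γ' Δ' (.comp D) → SSub Γ' (some D) Δ'

def SSub.wk {Γ' : Ctx V W} {Δ Δ' : Stoup V W} (B : VTy V W) :
    SSub Γ' Δ Δ' → SSub (B :: Γ') Δ Δ'
  | .empty => .empty
  | .term u => .term (u.wk B)

/-- The identity on the stoup. -/
def SSub.id (Γ : Ctx V W) : (Δ : Stoup V W) → SSub Γ Δ Δ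
  | none => .empty
  | some _ => .term .svar

/-- Simultaneous (capture-avoiding) substitution for the context and the stoup. -/
def Tm.sub {Γ Γ' : Ctx V W} {Δ Δ' : Stoup V W} {A : VTy V W} :
    Tm Γ Δ A → VSub Γ Γ' → SSub Γ' Δ Δ' → Tm Γ' Δ' A
  | .var x, σ, .empty => σ _ x
  | .star, _, .empty => .star
  | .pair t u, σ, .empty => .pair (t.sub σ .empty) (u.sub σ .empty)
  | .fst t, σ, .empty => .fst (t.sub σ .empty)
  | .snd t, σ, .empty => .snd (t.sub σ .empty)
  | .lam t, σ, .empty => .lam (t.sub (σ.lift _) .empty)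
  | .app t u, σ, .empty => .app (t.sub σ .empty) (u.sub σ .empty)
  | .svar, _, .term u => u
  | .cstar, _, _ => .cstar
  | .cpair t u, σ, s => .cpair (t.sub σ s) (u.sub σ s)
  | .cfst t, σ, s => .cfst (t.sub σ s)
  | .csnd t, σ, s => .csnd (t.sub σ s)
  | .clam t, σ, s => .clam (t.sub (σ.lift _) (s.wk _))
  | .capp t u, σ, s => .capp (t.sub σ s) (u.sub σ .empty)
  | .top, _, .empty => .top
  | .ilet t u, σ, s => .ilet (t.sub σ s) (u.sub σ .empty)
  | .bang t, σ, .empty => .bang (t.sub σ .empty)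
  | .blet t u, σ, s => .blet (t.sub σ s) (u.sub (σ.lift _) .empty)
  | .ten t u, σ, s => .ten (t.sub σ .empty) (u.sub σ s)
  | .tlet r t, σ, s => .tlet (r.sub σ s) (t.sub (σ.lift _) (.term .svar))
  | .image t, σ, s => .image (t.sub σ s)
  | .inl t, σ, s => .inl (t.sub σ s)
  | .inr t, σ, s => .inr (t.sub σ s)
  | .cases r t u, σ, s =>
      .cases (r.sub σ s) (t.sub σ (.term .svar)) (u.sub σ (.term .svar))
  | .llam t, σ, .empty => .llam (t.sub σ (.term .svar))
  | .lapp r t, σ, s => .lapp (r.sub σ .empty) (t.sub σ s)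

/-- The identity substitution. -/
def VSub.id (Γ : Ctx V W) : VSub Γ Γ := fun _ x => .var x

/-- The substitution `[u/x]` for the most recent variable `x`. -/
def VSub.single {Γ : Ctx V W} {B : VTy V W} (u : Tm Γ none B) : VSub (B :: Γ) Γ
  | _, .zero => u
  | _, .succ x => .var x

/-- `t[u/x]` for the most recent variable `x` of the context. -/
def Tm.inst {Γ : Ctx V W} {Δ : Stoup V W} {A B : VTy V W} (t : Tm (B :: Γ) Δ A)
    (u : Tm Γ none B) : Tm Γ Δ A :=
  t.sub (.single u) (.id Γ Δ)

/-- `t[u/z]` for the variable `z` of the stoup. -/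
def Tm.linst {Γ : Ctx V W} {Δ : Stoup V W} {D : CTy V W} {A : VTy V W}
    (t : Tm Γ (some D) A) (u : Tm Γ Δ (.comp D)) : Tm Γ Δ A :=
  t.sub (.id Γ) (.term u)

/-! ## The equational theory -/

/-- `Eqv t u` is the judgement `Γ | Δ ⊢ t = u : A`: the least congruence that contains the
equalities of the calculus. -/
inductive Eqv : {Γ : Ctx V W} → {Δ : Stoup V W} → {A : VTy V W} →
    Tm Γ Δ A → Tm Γ Δ A → Prop
  -- equivalence relation
  | refl {Γ : Ctx V W} {Δ : Stoup V W} {A : VTy V W} (t : Tm Γ Δ A) : Eqv t t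
  | symm {Γ : Ctx V W} {Δ : Stoup V W} {A : VTy V W} {t u : Tm Γ Δ A} : Eqv t u → Eqv u t
  | trans {Γ : Ctx V W} {Δ : Stoup V W} {A : VTy V W} {s t u : Tm Γ Δ A} :
      Eqv s t → Eqv t u → Eqv s u
  -- congruence
  | pair {Γ : Ctx V W} {A B : VTy V W} {t t' : Tm Γ none A} {u u' : Tm Γ none B} :
      Eqv t t' → Eqv u u' → Eqv (.pair t u) (.pair t' u')
  | fst {Γ : Ctx V W} {A B : VTy V W} {t t' : Tm Γ none (.prod A B)} :
      Eqv t t' → Eqv (.fst t) (.fst t')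
  | snd {Γ : Ctx V W} {A B : VTy V W} {t t' : Tm Γ none (.prod A B)} :
      Eqv t t' → Eqv (.snd t) (.snd t')
  | lam {Γ : Ctx V W} {A B : VTy V W} {t t' : Tm (A :: Γ) none B} :
      Eqv t t' → Eqv (.lam t) (.lam t')
  | app {Γ : Ctx V W} {A B : VTy V W} {t t' : Tm Γ none (.arr A B)} {u u' : Tm Γ none A} :
      Eqv t t' → Eqv u u' → Eqv (.app t u) (.app t' u')
  | cpair {Γ : Ctx V W} {Δ : Stoup V W} {A B : CTy V W} {t t' : Tm Γ Δ (.comp A)}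
      {u u' : Tm Γ Δ (.comp B)} : Eqv t t' → Eqv u u' → Eqv (.cpair t u) (.cpair t' u')
  | cfst {Γ : Ctx V W} {Δ : Stoup V W} {A B : CTy V W} {t t' : Tm Γ Δ (.comp (.amp A B))} :
      Eqv t t' → Eqv (.cfst t) (.cfst t')
  | csnd {Γ : Ctx V W} {Δ : Stoup V W} {A B : CTy V W} {t t' : Tm Γ Δ (.comp (.amp A B))} :
      Eqv t t' → Eqv (.csnd t) (.csnd t')
  | clam {Γ : Ctx V W} {Δ : Stoup V W} {A : VTy V W} {B : CTy V W}
      {t t' : Tm (A :: Γ) Δ (.comp B)} : Eqv t t' → Eqv (.clam t) (.clam t')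
  | capp {Γ : Ctx V W} {Δ : Stoup V W} {A : VTy V W} {B : CTy V W}
      {t t' : Tm Γ Δ (.comp (.pow A B))} {u u' : Tm Γ none A} :
      Eqv t t' → Eqv u u' → Eqv (.capp t u) (.capp t' u')
  | ilet {Γ : Ctx V W} {Δ : Stoup V W} {A : CTy V W} {t t' : Tm Γ Δ (.comp .I)}
      {u u' : Tm Γ none (.comp A)} : Eqv t t' → Eqv u u' → Eqv (.ilet t u) (.ilet t' u')
  | bang {Γ : Ctx V W} {A : VTy V W} {t t' : Tm Γ none A} :
      Eqv t t' → Eqv (.bang t) (.bang t')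
  | blet {Γ : Ctx V W} {Δ : Stoup V W} {A : VTy V W} {B : CTy V W}
      {t t' : Tm Γ Δ (.comp (.bang A))} {u u' : Tm (A :: Γ) none (.comp B)} :
      Eqv t t' → Eqv u u' → Eqv (.blet t u) (.blet t' u')
  | ten {Γ : Ctx V W} {Δ : Stoup V W} {A : VTy V W} {B : CTy V W} {t t' : Tm Γ none A}
      {u u' : Tm Γ Δ (.comp B)} : Eqv t t' → Eqv u u' → Eqv (.ten t u) (.ten t' u')
  | tlet {Γ : Ctx V W} {Δ : Stoup V W} {A : VTy V W} {B C : CTy V W}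
      {s s' : Tm Γ Δ (.comp (.copow A B))} {t t' : Tm (A :: Γ) (some B) (.comp C)} :
      Eqv s s' → Eqv t t' → Eqv (.tlet s t) (.tlet s' t')
  | image {Γ : Ctx V W} {Δ : Stoup V W} {A : CTy V W} {t t' : Tm Γ Δ (.comp .zero)} :
      Eqv t t' → Eqv (.image (A := A) t) (.image t')
  | inl {Γ : Ctx V W} {Δ : Stoup V W} {A B : CTy V W} {t t' : Tm Γ Δ (.comp A)} :
      Eqv t t' → Eqv (.inl (B := B) t) (.inl t')
  | inr {Γ : Ctx V W} {Δ : Stoup V W} {A B : CTy V W} {t t' : Tm Γ Δ (.comp B)} :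
      Eqv t t' → Eqv (.inr (A := A) t) (.inr t')
  | cases {Γ : Ctx V W} {Δ : Stoup V W} {A B C : CTy V W}
      {s s' : Tm Γ Δ (.comp (.plus A B))} {t t' : Tm Γ (some A) (.comp C)}
      {u u' : Tm Γ (some B) (.comp C)} :
      Eqv s s' → Eqv t t' → Eqv u u' → Eqv (.cases s t u) (.cases s' t' u')
  | llam {Γ : Ctx V W} {A B : CTy V W} {t t' : Tm Γ (some A) (.comp B)} :
      Eqv t t' → Eqv (.llam t) (.llam t')
  | lapp {Γ : Ctx V W} {Δ : Stoup V W} {A B : CTy V W} {s s' : Tm Γ none (.lolli A B)}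
      {t t' : Tm Γ Δ (.comp A)} : Eqv s s' → Eqv t t' → Eqv (.lapp s t) (.lapp s' t')
  -- equalities
  | one_eta {Γ : Ctx V W} (t : Tm Γ none .one) : Eqv t .star
  | fst_beta {Γ : Ctx V W} {A B : VTy V W} (t : Tm Γ none A) (u : Tm Γ none B) :
      Eqv (.fst (.pair t u)) t
  | snd_beta {Γ : Ctx V W} {A B : VTy V W} (t : Tm Γ none A) (u : Tm Γ none B) :
      Eqv (.snd (.pair t u)) u
  | prod_eta {Γ : Ctx V W} {A B : VTy V W} (t : Tm Γ none (.prod A B)) :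
      Eqv (.pair (.fst t) (.snd t)) t
  | arr_beta {Γ : Ctx V W} {A B : VTy V W} (t : Tm (A :: Γ) none B) (u : Tm Γ none A) :
      Eqv (.app (.lam t) u) (t.inst u)
  | arr_eta {Γ : Ctx V W} {A B : VTy V W} (t : Tm Γ none (.arr A B)) :
      Eqv (.lam (.app (t.wk A) (.var .zero))) t
  | cone_eta {Γ : Ctx V W} {Δ : Stoup V W} (t : Tm Γ Δ (.comp .one)) : Eqv t .cstar
  | cfst_beta {Γ : Ctx V W} {Δ : Stoup V W} {A B : CTy V W} (t : Tm Γ Δ (.comp A))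
      (u : Tm Γ Δ (.comp B)) : Eqv (.cfst (.cpair t u)) t
  | csnd_beta {Γ : Ctx V W} {Δ : Stoup V W} {A B : CTy V W} (t : Tm Γ Δ (.comp A))
      (u : Tm Γ Δ (.comp B)) : Eqv (.csnd (.cpair t u)) u
  | amp_eta {Γ : Ctx V W} {Δ : Stoup V W} {A B : CTy V W} (t : Tm Γ Δ (.comp (.amp A B))) :
      Eqv (.cpair (.cfst t) (.csnd t)) t
  | pow_beta {Γ : Ctx V W} {Δ : Stoup V W} {A : VTy V W} {B : CTy V W}
      (t : Tm (A :: Γ) Δ (.comp B)) (u : Tm Γ none A) : Eqv (.capp (.clam t) u) (t.inst u)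
  | pow_eta {Γ : Ctx V W} {Δ : Stoup V W} {A : VTy V W} {B : CTy V W}
      (t : Tm Γ Δ (.comp (.pow A B))) : Eqv (.clam (.capp (t.wk A) (.var .zero))) t
  | I_beta {Γ : Ctx V W} {A : CTy V W} (t : Tm Γ none (.comp A)) : Eqv (.ilet .top t) t
  | I_eta {Γ : Ctx V W} {Δ : Stoup V W} {A : CTy V W} (t : Tm Γ Δ (.comp .I))
      (u : Tm Γ (some .I) (.comp A)) : Eqv (.ilet t (u.linst .top)) (u.linst t)
  | bang_beta {Γ : Ctx V W} {A : VTy V W} {B : CTy V W} (t : Tm Γ none A)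
      (u : Tm (A :: Γ) none (.comp B)) : Eqv (.blet (.bang t) u) (u.inst t)
  | bang_eta {Γ : Ctx V W} {Δ : Stoup V W} {A : VTy V W} {B : CTy V W}
      (t : Tm Γ Δ (.comp (.bang A))) (u : Tm Γ (some (.bang A)) (.comp B)) :
      Eqv (.blet t ((u.wk A).linst (.bang (.var .zero)))) (u.linst t)
  | copow_beta {Γ : Ctx V W} {Δ : Stoup V W} {A : VTy V W} {B C : CTy V W}
      (t : Tm Γ none A) (s : Tm Γ Δ (.comp B)) (u : Tm (A :: Γ) (some B) (.comp C)) :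
      Eqv (.tlet (.ten t s) u) (u.sub (.single t) (.term s))
  | copow_eta {Γ : Ctx V W} {Δ : Stoup V W} {A : VTy V W} {B C : CTy V W}
      (t : Tm Γ Δ (.comp (.copow A B))) (u : Tm Γ (some (.copow A B)) (.comp C)) :
      Eqv (.tlet t ((u.wk A).linst (.ten (.var .zero) .svar))) (u.linst t)
  | zero_eta {Γ : Ctx V W} {Δ : Stoup V W} {A : CTy V W} (t : Tm Γ Δ (.comp .zero))
      (u : Tm Γ (some .zero) (.comp A)) : Eqv (.image t) (u.linst t)
  | inl_beta {Γ : Ctx V W} {Δ : Stoup V W} {A B C : CTy V W} (t : Tm Γ Δ (.comp A))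
      (u : Tm Γ (some A) (.comp C)) (u' : Tm Γ (some B) (.comp C)) :
      Eqv (.cases (.inl t) u u') (u.linst t)
  | inr_beta {Γ : Ctx V W} {Δ : Stoup V W} {A B C : CTy V W} (t : Tm Γ Δ (.comp B))
      (u : Tm Γ (some A) (.comp C)) (u' : Tm Γ (some B) (.comp C)) :
      Eqv (.cases (.inr t) u u') (u'.linst t)
  | plus_eta {Γ : Ctx V W} {Δ : Stoup V W} {A B C : CTy V W} (t : Tm Γ Δ (.comp (.plus A B)))
      (u : Tm Γ (some (.plus A B)) (.comp C)) :
      Eqv (.cases t (u.linst (.inl .svar)) (u.linst (.inr .svar))) (u.linst t)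
  | lolli_beta {Γ : Ctx V W} {Δ : Stoup V W} {A B : CTy V W} (t : Tm Γ (some A) (.comp B))
      (u : Tm Γ Δ (.comp A)) : Eqv (.lapp (.llam t) u) (t.linst u)
  | lolli_eta {Γ : Ctx V W} {A B : CTy V W} (t : Tm Γ none (.lolli A B)) :
      Eqv (.llam (.lapp t .svar)) t

/-! ## The self-translation on types -/

open Classical in
/-- The translation of a computation type constant: the result type, if it is a constant, goes
to `I`, and every other constant to itself. -/
noncomputable def CTy.trConst (R : CTy V W) (a : W) : CTy V W :=
  if CTy.const a = R then .I else .const a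

mutual
/-- The translation of value types, relative to the result type `R`. -/
noncomputable def vtr (R : CTy V W) : VTy V W → VTy V W
  | .const a => .const a
  | .one => .one
  | .prod A B => .prod (vtr R A) (vtr R B)
  | .arr A B => .arr (vtr R A) (vtr R B)
  | .comp A => .lolli (ctr R A) R
  | .lolli A B => .lolli (ctr R B) (ctr R A)

/-- The translation of computation types, relative to the result type `R`. -/
noncomputable def ctr (R : CTy V W) : CTy V W → CTy V W
  | .const a => .trConst R a
  | .one => .zero
  | .amp A B => .plus (ctr R A) (ctr R B)
  | .pow A B => .copow (vtr R A) (ctr R B)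
  | .I => R
  | .bang A => .pow (vtr R A) R
  | .copow A B => .pow (vtr R A) (ctr R B)
  | .zero => .one
  | .plus A B => .amp (ctr R A) (ctr R B)
end

/-- The translation of contexts. -/
noncomputable abbrev Ctx.tr (R : CTy V W) (Γ : Ctx V W) : Ctx V W := List.map (vtr R) Γ

/-! ## The self-translation on terms -/

/-- A variable of the context, as a variable of the translated context. -/
noncomputable def Var.tr (R : CTy V W) {Γ : Ctx V W} {A : VTy V W} :
    Var Γ A → Var (Ctx.tr R Γ) (vtr R A)
  | .zero => .zero
  | .succ x => .succ (x.tr R)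

/-- The type of the translation of a term in `Tm Γ Δ A`.  Terms with an empty stoup are
translated covariantly, terms with a nonempty stoup contravariantly; there are no terms with a
nonempty stoup whose type is not a computation type. -/
def TrTm (R : CTy V W) (Γ : Ctx V W) : Stoup V W → VTy V W → Type (max u v)
  | none, A => Tm (Ctx.tr R Γ) none (vtr R A)
  | some D, .comp B => Tm (Ctx.tr R Γ) (some (ctr R B)) (.comp (ctr R D))
  | some _, _ => PEmpty

/-- The translation of terms, on terms with an empty and with a nonempty stoup. -/
noncomputable def Tm.trAux (R : CTy V W) {Γ : Ctx V W} :
    {Δ : Stoup V W} → {A : VTy V W} → Tm Γ Δ A → TrTm R Γ Δ A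
  -- empty stoup
  | none, _, .var x => (.var (x.tr R) : Tm _ _ _)
  | none, _, .star => (.star : Tm _ _ _)
  | none, _, .pair t u => (.pair (t.trAux R) (u.trAux R) : Tm _ _ _)
  | none, _, .fst (A := A) (B := B) t =>
      (.fst (A := vtr R A) (B := vtr R B) (t.trAux R) : Tm _ _ _)
  | none, _, .snd (A := A) (B := B) t =>
      (.snd (A := vtr R A) (B := vtr R B) (t.trAux R) : Tm _ _ _)
  | none, _, .lam t => (.lam (t.trAux R) : Tm _ _ _)
  | none, _, .app (A := A) (B := B) t u =>
      (.app (A := vtr R A) (B := vtr R B) (t.trAux R) (u.trAux R) : Tm _ _ _)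
  | none, _, .cstar => (.llam (.image .svar) : Tm _ _ _)
  | none, _, .cpair t u =>
      (.llam (.cases .svar (.lapp (t.trAux R) .svar) (.lapp (u.trAux R) .svar)) : Tm _ _ _)
  | none, _, .cfst (A := A) (B := B) t =>
      (.llam (.lapp (A := .plus (ctr R A) (ctr R B)) (t.trAux R) (.inl .svar)) : Tm _ _ _)
  | none, _, .csnd (A := A) (B := B) t =>
      (.llam (.lapp (A := .plus (ctr R A) (ctr R B)) (t.trAux R) (.inr .svar)) : Tm _ _ _)
  | none, _, .clam t => (.llam (.tlet .svar (.lapp (t.trAux R) .svar)) : Tm _ _ _)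
  | none, _, .capp (A := A) (B := B) s t =>
      (.llam (.lapp (A := .copow (vtr R A) (ctr R B)) (s.trAux R)
        (.ten (t.trAux R) .svar)) : Tm _ _ _)
  | none, _, .top => (.llam .svar : Tm _ _ _)
  | none, _, .ilet t u =>
      (.llam (.lapp (A := R) (t.trAux R) (.lapp (u.trAux R) .svar)) : Tm _ _ _)
  | none, _, .bang t => (.llam (.capp .svar (t.trAux R)) : Tm _ _ _)
  | none, _, .blet (A := A) t u =>
      (.llam (.lapp (A := .pow (vtr R A) R) (t.trAux R)
        (.clam (.lapp (u.trAux R) .svar))) : Tm _ _ _)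
  | none, _, .ten t u => (.llam (.lapp (u.trAux R) (.capp .svar (t.trAux R))) : Tm _ _ _)
  | none, _, .tlet (A := A) (B := B) s t =>
      (.llam (.lapp (A := .pow (vtr R A) (ctr R B)) (s.trAux R) (.clam (t.trAux R))) : Tm _ _ _)
  | none, _, .image t => (.llam (.lapp (A := .one) (t.trAux R) .cstar) : Tm _ _ _)
  | none, _, .inl t => (.llam (.lapp (t.trAux R) (.cfst .svar)) : Tm _ _ _)
  | none, _, .inr t => (.llam (.lapp (t.trAux R) (.csnd .svar)) : Tm _ _ _)
  | none, _, .cases (A := A) (B := B) s t u =>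
      (.llam (.lapp (A := .amp (ctr R A) (ctr R B)) (s.trAux R)
        (.cpair (t.trAux R) (u.trAux R))) : Tm _ _ _)
  | none, _, .llam t => (.llam (t.trAux R) : Tm _ _ _)
  | none, _, .lapp (A := A) (B := B) s t =>
      (.llam (.lapp (A := ctr R A) (t.trAux R)
        (.lapp (A := ctr R B) (s.trAux R) .svar)) : Tm _ _ _)
  -- nonempty stoup
  | some _, _, .svar => (.svar : Tm _ _ _)
  | some _, _, .cstar => (.image .svar : Tm _ _ _)
  | some _, _, .cpair t u => (.cases .svar (t.trAux R) (u.trAux R) : Tm _ _ _)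
  | some _, _, .cfst (A := A) (B := B) t =>
      (Tm.linst (D := .plus (ctr R A) (ctr R B)) (t.trAux R) (.inl .svar) : Tm _ _ _)
  | some _, _, .csnd (A := A) (B := B) t =>
      (Tm.linst (D := .plus (ctr R A) (ctr R B)) (t.trAux R) (.inr .svar) : Tm _ _ _)
  | some _, _, .clam t => (.tlet .svar (t.trAux R) : Tm _ _ _)
  | some _, _, .capp (A := A) (B := B) s t =>
      (Tm.linst (D := .copow (vtr R A) (ctr R B)) (s.trAux R)
        (.ten (t.trAux R) .svar) : Tm _ _ _)
  | some _, _, .ilet t u =>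
      (Tm.linst (D := R) (t.trAux R) (.lapp (u.trAux R) .svar) : Tm _ _ _)
  | some _, _, .blet (A := A) t u =>
      (Tm.linst (D := .pow (vtr R A) R) (t.trAux R)
        (.clam (.lapp (u.trAux R) .svar)) : Tm _ _ _)
  | some _, _, .ten t u => (Tm.linst (u.trAux R) (.capp .svar (t.trAux R)) : Tm _ _ _)
  | some _, _, .tlet (A := A) (B := B) s t =>
      (Tm.linst (D := .pow (vtr R A) (ctr R B)) (s.trAux R) (.clam (t.trAux R)) : Tm _ _ _)
  | some _, _, .image t => (Tm.linst (D := .one) (t.trAux R) .cstar : Tm _ _ _)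
  | some _, _, .inl t => (Tm.linst (t.trAux R) (.cfst .svar) : Tm _ _ _)
  | some _, _, .inr t => (Tm.linst (t.trAux R) (.csnd .svar) : Tm _ _ _)
  | some _, _, .cases (A := A) (B := B) s t u =>
      (Tm.linst (D := .amp (ctr R A) (ctr R B)) (s.trAux R)
        (.cpair (t.trAux R) (u.trAux R)) : Tm _ _ _)
  | some _, _, .lapp (A := A) (B := B) s t =>
      (Tm.linst (D := ctr R A) (t.trAux R) (.lapp (A := ctr R B) (s.trAux R) .svar) : Tm _ _ _)

/-- The translation of a term `Γ ⊢ t : A` with an empty stoup. -/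
noncomputable def Tm.trV (R : CTy V W) {Γ : Ctx V W} {A : VTy V W} (t : Tm Γ none A) :
    Tm (Ctx.tr R Γ) none (vtr R A) :=
  t.trAux R

/-- The translation of a term `Γ | z : A ⊢ t : B` with a nonempty stoup. -/
noncomputable def Tm.trC (R : CTy V W) {Γ : Ctx V W} {A B : CTy V W}
    (t : Tm Γ (some A) (.comp B)) : Tm (Ctx.tr R Γ) (some (ctr R B)) (.comp (ctr R A)) :=
  t.trAux R

/-! ## The type isomorphisms -/

/-- `R` is a computation type constant or `I`. -/
def CTy.IsConstOrI (R : CTy V W) : Prop := (∃ a : W, R = .const a) ∨ R = .I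

theorem CTy.IsConstOrI.tr_self {R : CTy V W} (hR : R.IsConstOrI) : ctr R R = .I := by
  obtain ⟨a, rfl⟩ | rfl := hR
  · simp [ctr, CTy.trConst]
  · rfl

theorem CTy.IsConstOrI.tr_tr_const {R : CTy V W} (hR : R.IsConstOrI) (a : W) :
    ctr R (ctr R (.const a)) = .const a := by
  by_cases h : CTy.const a = R
  · subst h
    simp [ctr, CTy.trConst]
  · simp [ctr, CTy.trConst, h]

/-- The variable of the stoup, along an identity between computation types. -/
def Tm.svarEq {Γ : Ctx V W} {A B : CTy V W} (h : A = B) : Tm Γ (some A) (.comp B) :=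
  h ▸ Tm.svar

/-- The term `⊤`, along an identity between computation types. -/
def Tm.topEq {Γ : Ctx V W} {A : CTy V W} (h : A = .I) : Tm Γ none (.comp A) :=
  h ▸ Tm.top

mutual
/-- The closed term `ϑ_A : A°° → A`. -/
noncomputable def viso {R : CTy V W} (hR : R.IsConstOrI) :
    (A : VTy V W) → Tm ([] : Ctx V W) none (.arr (vtr R (vtr R A)) A)
  | .const _ => .lam (.var .zero)
  | .one => .lam .star
  | .prod A B =>
      .lam (A := .prod (vtr R (vtr R A)) (vtr R (vtr R B)))
        (.pair (.app ((viso hR A).closed _) (.fst (.var .zero)))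
          (.app ((viso hR B).closed _) (.snd (.var .zero))))
  | .arr A B =>
      .lam (A := .arr (vtr R (vtr R A)) (vtr R (vtr R B)))
        (.lam (.app ((viso hR B).closed _)
          (.app (.var (.succ .zero)) (.app ((visoInv hR A).closed _) (.var .zero)))))
  | .comp A =>
      .lam (A := .lolli (ctr R R) (ctr R (ctr R A)))
        (.lapp ((ciso hR A).closed _) (.lapp (.var .zero) (.topEq hR.tr_self)))
  | .lolli A B =>
      .lam (A := .lolli (ctr R (ctr R A)) (ctr R (ctr R B)))
        (.llam (.lapp ((ciso hR B).closed _)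
          (.lapp (.var .zero) (.lapp ((cisoInv hR A).closed _) .svar))))

/-- The closed term `ϑ_A⁻¹ : A → A°°`. -/
noncomputable def visoInv {R : CTy V W} (hR : R.IsConstOrI) :
    (A : VTy V W) → Tm ([] : Ctx V W) none (.arr A (vtr R (vtr R A)))
  | .const _ => .lam (.var .zero)
  | .one => .lam .star
  | .prod A B =>
      .lam (B := .prod (vtr R (vtr R A)) (vtr R (vtr R B)))
        (.pair (.app ((visoInv hR A).closed _) (.fst (.var .zero)))
          (.app ((visoInv hR B).closed _) (.snd (.var .zero))))
  | .arr A B =>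
      .lam (B := .arr (vtr R (vtr R A)) (vtr R (vtr R B)))
        (.lam (.app ((visoInv hR B).closed _)
          (.app (.var (.succ .zero)) (.app ((viso hR A).closed _) (.var .zero)))))
  | .comp A =>
      .lam (B := .lolli (ctr R R) (ctr R (ctr R A)))
        (.llam (.ilet (.svarEq hR.tr_self) (.lapp ((cisoInv hR A).closed _) (.var .zero))))
  | .lolli A B =>
      .lam (B := .lolli (ctr R (ctr R A)) (ctr R (ctr R B)))
        (.llam (.lapp ((cisoInv hR B).closed _)
          (.lapp (.var .zero) (.lapp ((ciso hR A).closed _) .svar))))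

/-- The closed linear term `A°° ⊸ A` for a computation type `A`. -/
noncomputable def ciso {R : CTy V W} (hR : R.IsConstOrI) :
    (A : CTy V W) → Tm ([] : Ctx V W) none (.lolli (ctr R (ctr R A)) A)
  | .const a => .llam (.svarEq (hR.tr_tr_const a))
  | .one => .llam .cstar
  | .amp A B =>
      .llam (A := .amp (ctr R (ctr R A)) (ctr R (ctr R B)))
        (.cpair (.lapp ((ciso hR A).closed _) (.cfst .svar))
          (.lapp ((ciso hR B).closed _) (.csnd .svar)))
  | .pow A B =>
      .llam (A := .pow (vtr R (vtr R A)) (ctr R (ctr R B)))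
        (.clam (.lapp ((ciso hR B).closed _)
          (.capp .svar (.app ((visoInv hR A).closed _) (.var .zero)))))
  | .I => .llam (.svarEq hR.tr_self)
  | .bang A =>
      .llam (A := .copow (vtr R (vtr R A)) (ctr R R))
        (.tlet .svar (.ilet (.svarEq hR.tr_self)
          (.bang (.app ((viso hR A).closed _) (.var .zero)))))
  | .copow A B =>
      .llam (A := .copow (vtr R (vtr R A)) (ctr R (ctr R B)))
        (.tlet .svar (.ten (.app ((viso hR A).closed _) (.var .zero))
          (.lapp ((ciso hR B).closed _) .svar)))
  | .zero => .llam .svar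
  | .plus A B =>
      .llam (A := .plus (ctr R (ctr R A)) (ctr R (ctr R B)))
        (.cases .svar (.inl (.lapp ((ciso hR A).closed _) .svar))
          (.inr (.lapp ((ciso hR B).closed _) .svar)))

/-- The closed linear term `A ⊸ A°°` for a computation type `A`. -/
noncomputable def cisoInv {R : CTy V W} (hR : R.IsConstOrI) :
    (A : CTy V W) → Tm ([] : Ctx V W) none (.lolli A (ctr R (ctr R A)))
  | .const a => .llam (.svarEq (hR.tr_tr_const a).symm)
  | .one => .llam .cstar
  | .amp A B =>
      .llam (B := .amp (ctr R (ctr R A)) (ctr R (ctr R B)))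
        (.cpair (.lapp ((cisoInv hR A).closed _) (.cfst .svar))
          (.lapp ((cisoInv hR B).closed _) (.csnd .svar)))
  | .pow A B =>
      .llam (B := .pow (vtr R (vtr R A)) (ctr R (ctr R B)))
        (.clam (.lapp ((cisoInv hR B).closed _)
          (.capp .svar (.app ((viso hR A).closed _) (.var .zero)))))
  | .I => .llam (.svarEq hR.tr_self.symm)
  | .bang A =>
      .llam (B := .copow (vtr R (vtr R A)) (ctr R R))
        (.blet .svar (.ten (.app ((visoInv hR A).closed _) (.var .zero))
          (.topEq hR.tr_self)))
  | .copow A B =>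
      .llam (B := .copow (vtr R (vtr R A)) (ctr R (ctr R B)))
        (.tlet .svar (.ten (.app ((visoInv hR A).closed _) (.var .zero))
          (.lapp ((cisoInv hR B).closed _) .svar)))
  | .zero => .llam .svar
  | .plus A B =>
      .llam (B := .plus (ctr R (ctr R A)) (ctr R (ctr R B)))
        (.cases .svar (.inl (.lapp ((cisoInv hR A).closed _) .svar))
          (.inr (.lapp ((cisoInv hR B).closed _) .svar)))
end

/-- Closed terms `f : A → B` and `g : B → A` with `λx. f (g x) = λx. x` and
`λx. g (f x) = λx. x`. -/
def IsVIso {A B : VTy V W} (f : Tm ([] : Ctx V W) none (.arr A B))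
    (g : Tm ([] : Ctx V W) none (.arr B A)) : Prop :=
  Eqv (.lam (.app (f.closed [B]) (.app (g.closed [B]) (.var .zero)))) (.lam (.var .zero)) ∧
    Eqv (.lam (.app (g.closed [A]) (.app (f.closed [A]) (.var .zero)))) (.lam (.var .zero))

/-- Closed linear terms `f : A ⊸ B` and `g : B ⊸ A` that are mutually inverse. -/
def IsCIso {A B : CTy V W} (f : Tm ([] : Ctx V W) none (.lolli A B))
    (g : Tm ([] : Ctx V W) none (.lolli B A)) : Prop :=
  Eqv (.llam (.lapp f (.lapp g .svar))) (.llam .svar) ∧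
    Eqv (.llam (.lapp g (.lapp f .svar))) (.llam .svar)

/-- The substitution of `ϑ⁻¹ x` for every variable `x` of the twice translated context. -/
noncomputable def invSub {R : CTy V W} (hR : R.IsConstOrI) :
    (Γ : Ctx V W) → VSub (Ctx.tr R (Ctx.tr R Γ)) Γ
  | C :: _, _, .zero => .app ((visoInv hR C).closed _) (.var .zero)
  | C :: Γ, _, .succ x => (invSub hR Γ _ x).wk C

end EEC

namespace EEC
universe u v
variable {V : Type u} {W : Type v}

/-! ## Renaming and substitution -/

/-- Composition of simultaneous substitutions. -/
def VSub.comp {Γ Γ' Γ'' : Ctx V W} (σ : VSub Γ Γ') (τ : VSub Γ' Γ'') : VSub Γ Γ'' :=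
  fun A x => (σ A x).sub τ .empty

/-- A renaming, as a substitution. -/
def Ren.toVSub {Γ Γ' : Ctx V W} (ρ : Ren Γ Γ') : VSub Γ Γ' := fun A x => .var (ρ A x)

/-- Substitution in a substitution for the stoup. -/
def SSub.sub {Γ Γ' : Ctx V W} {Δ Δ' Δ'' : Stoup V W} :
    SSub Γ Δ Δ' → VSub Γ Γ' → SSub Γ' Δ' Δ'' → SSub Γ' Δ Δ''
  | .empty, _, r => r
  | .term u, τ, r => .term (u.sub τ r)

/-- Renaming in a substitution for the stoup. -/
def SSub.ren {Γ Γ' : Ctx V W} {Δ Δ' : Stoup V W} : SSub Γ Δ Δ' → Ren Γ Γ' → SSub Γ' Δ Δ'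
  | .empty, _ => .empty
  | .term u, ρ => .term (u.ren ρ)

section Syntactic

variable {Γ Γ' Γ'' : Ctx V W} {Δ Δ' Δ'' : Stoup V W} {A B : VTy V W}

theorem Ren.toVSub_lift (ρ : Ren Γ Γ') (B : VTy V W) :
    (ρ.lift B).toVSub = ρ.toVSub.lift B := by
  funext A x
  cases x <;> rfl

theorem VSub.id_lift (B : VTy V W) : (VSub.id Γ).lift B = VSub.id (B :: Γ) := by
  funext A x
  cases x <;> rfl

theorem SSub.id_wk (B : VTy V W) : (SSub.id Γ Δ).wk B = SSub.id (B :: Γ) Δ := by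
  cases Δ <;> rfl

theorem SSub.id_some (D : CTy V W) : SSub.id Γ (some D) = .term .svar := rfl

theorem SSub.id_none : SSub.id Γ (none : Stoup V W) = .empty := rfl

theorem Tm.ren_eq_sub (t : Tm Γ Δ A) (ρ : Ren Γ Γ') : t.ren ρ = t.sub ρ.toVSub (.id Γ' Δ) := by
  induction t generalizing Γ' <;>
    simp only [SSub.id_none, SSub.id_some, Tm.ren, Tm.sub, ← Ren.toVSub_lift, SSub.id_wk, *]
  rfl

theorem Tm.sub_id (t : Tm Γ Δ A) : t.sub (.id Γ) (.id Γ Δ) = t := by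
  induction t <;> simp only [SSub.id_none, SSub.id_some, Tm.sub, VSub.id_lift, SSub.id_wk] <;>
    first | rfl | simp only [← SSub.id_none, ← SSub.id_some, *]

theorem Tm.ren_sub (t : Tm Γ Δ A) (ρ : Ren Γ Γ') (σ : VSub Γ' Γ'') (s : SSub Γ'' Δ Δ') :
    (t.ren ρ).sub σ s = t.sub (fun A x => σ A (ρ A x)) s := by
  have key : ∀ {Γ Γ' Γ'' : Ctx V W} (ρ : Ren Γ Γ') (σ : VSub Γ' Γ'') (B : VTy V W),
      (fun A x => σ.lift B A (ρ.lift B A x)) = VSub.lift (fun A x => σ A (ρ A x)) B := by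
    intro _ _ _ ρ σ B
    funext A x
    cases x <;> rfl
  induction t generalizing Γ' Γ'' Δ' <;> first
    | (cases s; simp only [Tm.ren, Tm.sub, *]; done)
    | simp only [Tm.ren, Tm.sub, *]

theorem Tm.ren_ren (t : Tm Γ Δ A) (ρ : Ren Γ Γ') (ρ' : Ren Γ' Γ'') :
    (t.ren ρ).ren ρ' = t.ren (fun A x => ρ' A (ρ A x)) := by
  rw [Tm.ren_eq_sub, Tm.ren_sub, Tm.ren_eq_sub]
  rfl

theorem SSub.wk_ren_lift (s : SSub Γ Δ Δ') (ρ : Ren Γ Γ') (B : VTy V W) :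
    (s.wk B).ren (ρ.lift B) = (s.ren ρ).wk B := by
  cases s with
  | empty => rfl
  | term u =>
    simp only [SSub.wk, SSub.ren, Tm.wk, Tm.ren_ren]
    rfl

theorem SSub.empty_ren (ρ : Ren Γ Γ') : SSub.empty.ren ρ = .empty := rfl

theorem SSub.term_ren {D : CTy V W} (u : Tm Γ Δ (.comp D)) (ρ : Ren Γ Γ') :
    (SSub.term u).ren ρ = .term (u.ren ρ) := rfl

theorem Tm.sub_ren (t : Tm Γ Δ A) (σ : VSub Γ Γ') (s : SSub Γ' Δ Δ') (ρ : Ren Γ' Γ'') :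
    (t.sub σ s).ren ρ = t.sub (fun A x => (σ A x).ren ρ) (s.ren ρ) := by
  have key : ∀ {Γ Γ' Γ'' : Ctx V W} (σ : VSub Γ Γ') (ρ : Ren Γ' Γ'') (B : VTy V W),
      (fun A x => (σ.lift B A x).ren (ρ.lift B)) =
        VSub.lift (fun A x => (σ A x).ren ρ) B := by
    intro _ _ _ σ ρ B
    funext A x
    cases x with
    | zero => rfl
    | succ x =>
      simp only [VSub.lift, Tm.wk, Tm.ren_ren]
      rfl
  induction t generalizing Γ' Γ'' Δ' <;> first
    | (cases s <;> rfl)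
    | (cases s; simp only [Tm.ren, Tm.sub, SSub.empty_ren, SSub.term_ren, *]; done)
    | simp only [Tm.ren, Tm.sub, SSub.empty_ren, SSub.term_ren, ← SSub.wk_ren_lift, *]

theorem Tm.wk_sub_lift (t : Tm Γ Δ A) (σ : VSub Γ Γ') (s : SSub Γ' Δ Δ') (B : VTy V W) :
    (t.wk B).sub (σ.lift B) (s.wk B) = (t.sub σ s).wk B := by
  simp only [Tm.wk, Tm.ren_sub, Tm.sub_ren]
  cases s <;> rfl

theorem SSub.wk_sub_lift (s : SSub Γ Δ Δ') (σ : VSub Γ Γ') (r : SSub Γ' Δ' Δ'')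
    (B : VTy V W) : (s.wk B).sub (σ.lift B) (r.wk B) = (s.sub σ r).wk B := by
  cases s with
  | empty => cases r; rfl
  | term u => exact congrArg _ (u.wk_sub_lift σ r B)

theorem VSub.lift_comp_lift (σ : VSub Γ Γ') (τ : VSub Γ' Γ'') (B : VTy V W) :
    (σ.lift B).comp (τ.lift B) = (σ.comp τ).lift B := by
  funext A x
  cases x with
  | zero => rfl
  | succ x => exact (σ _ x).wk_sub_lift τ .empty B

theorem SSub.svar_sub (D : CTy V W) (σ : VSub Γ Γ') :
    (SSub.term (.svar : Tm Γ (some D) _)).sub σ (.term .svar) = .term .svar := rfl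

theorem SSub.empty_sub (σ : VSub Γ Γ') (r : SSub Γ' none Δ) : SSub.empty.sub σ r = r := rfl

theorem Tm.sub_sub (t : Tm Γ Δ A) (σ : VSub Γ Γ') (s : SSub Γ' Δ Δ') (τ : VSub Γ' Γ'')
    (r : SSub Γ'' Δ' Δ'') : (t.sub σ s).sub τ r = t.sub (σ.comp τ) (s.sub τ r) := by
  induction t generalizing Γ' Γ'' Δ' Δ'' with
  | svar => cases s; rfl
  | var x => cases s; cases r; rfl
  | _ => first
    | simp only [Tm.sub, SSub.svar_sub, SSub.empty_sub, ← SSub.wk_sub_lift, VSub.lift_comp_lift, *]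
    | (cases s; cases r; simp only [Tm.sub, SSub.svar_sub, SSub.empty_sub, VSub.lift_comp_lift, *])

end Syntactic

/-- The extension of a substitution by a term for the most recent variable. -/
def VSub.cons {Γ Γ' : Ctx V W} {B : VTy V W} (u : Tm Γ' none B) (σ : VSub Γ Γ') :
    VSub (B :: Γ) Γ'
  | _, .zero => u
  | _, .succ x => σ _ x

section Syntactic

variable {Γ Γ' Γ'' : Ctx V W} {Δ Δ' Δ'' : Stoup V W} {A B : VTy V W}

theorem Tm.wk_sub (t : Tm Γ Δ A) (σ : VSub (B :: Γ) Γ') (s : SSub Γ' Δ Δ') :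
    (t.wk B).sub σ s = t.sub (fun A x => σ A (.succ x)) s :=
  t.ren_sub _ _ _

theorem Tm.wk_sub_cons (t : Tm Γ Δ A) (u : Tm Γ' none B) (σ : VSub Γ Γ') (s : SSub Γ' Δ Δ') :
    (t.wk B).sub (.cons u σ) s = t.sub σ s :=
  t.ren_sub _ _ _

theorem SSub.wk_sub_cons (s : SSub Γ Δ Δ') (u : Tm Γ' none B) (σ : VSub Γ Γ')
    (r : SSub Γ' Δ' Δ'') : (s.wk B).sub (.cons u σ) r = s.sub σ r := by
  cases s with
  | empty => rfl
  | term v => exact congrArg _ (v.wk_sub_cons u σ r)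

theorem VSub.comp_id (σ : VSub Γ Γ') : σ.comp (.id Γ') = σ := by
  funext A x
  exact (σ A x).sub_id

theorem VSub.id_comp (σ : VSub Γ Γ') : (VSub.id Γ).comp σ = σ := rfl

theorem SSub.sub_id (s : SSub Γ Δ Δ') : s.sub (.id Γ) (.id Γ Δ') = s := by
  cases s with
  | empty => rfl
  | term u => exact congrArg _ u.sub_id

theorem SSub.id_sub (σ : VSub Γ Γ') (s : SSub Γ' Δ Δ') : (SSub.id Γ Δ).sub σ s = s := by
  cases s <;> rfl

theorem VSub.single_eq_cons (u : Tm Γ none B) : VSub.single u = .cons u (.id Γ) := by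
  funext A x
  cases x <;> rfl

theorem VSub.cons_comp (u : Tm Γ' none B) (σ : VSub Γ Γ') (τ : VSub Γ' Γ'') :
    (VSub.cons u σ).comp τ = .cons (u.sub τ .empty) (σ.comp τ) := by
  funext A x
  cases x <;> rfl

theorem VSub.lift_comp_cons (u : Tm Γ'' none B) (σ : VSub Γ Γ') (τ : VSub Γ' Γ'') :
    (σ.lift B).comp (.cons u τ) = .cons u (σ.comp τ) := by
  funext A x
  cases x with
  | zero => rfl
  | succ x => exact (σ _ x).wk_sub_cons u τ .empty

theorem Tm.sub_id_empty (t : Tm Γ none A) : t.sub (.id Γ) .empty = t := t.sub_id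

theorem Tm.linst_svar {D : CTy V W} (t : Tm Γ (some D) A) : t.linst .svar = t := t.sub_id

theorem Tm.sub_id_svar {D : CTy V W} (t : Tm Γ (some D) A) :
    t.sub (.id Γ) (.term .svar) = t := t.sub_id

theorem Tm.sub_lift_inst (t : Tm (B :: Γ) Δ A) (σ : VSub Γ Γ') (s : SSub Γ' Δ Δ')
    (u : Tm Γ' none B) : (t.sub (σ.lift B) (s.wk B)).inst u = t.sub (.cons u σ) s := by
  rw [Tm.inst, Tm.sub_sub, VSub.single_eq_cons, VSub.lift_comp_cons, VSub.comp_id,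
    SSub.wk_sub_cons, SSub.sub_id]

theorem Tm.inst_sub (t : Tm (B :: Γ) Δ A) (u : Tm Γ none B) (σ : VSub Γ Γ')
    (s : SSub Γ' Δ Δ') :
    (t.inst u).sub σ s = (t.sub (σ.lift B) (s.wk B)).inst (u.sub σ .empty) := by
  rw [Tm.sub_lift_inst, Tm.inst, Tm.sub_sub, VSub.single_eq_cons, VSub.cons_comp, VSub.id_comp,
    SSub.id_sub]

theorem Tm.sub_linst {D : CTy V W} (t : Tm Γ (some D) A) (σ : VSub Γ Γ')
    (r : Tm Γ' Δ (.comp D)) : (t.sub σ (.term .svar)).linst r = t.sub σ (.term r) := by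
  rw [Tm.linst, Tm.sub_sub, VSub.comp_id]
  rfl

theorem Tm.linst_sub {D : CTy V W} (t : Tm Γ (some D) A) (u : Tm Γ Δ (.comp D)) (σ : VSub Γ Γ')
    (s : SSub Γ' Δ Δ') :
    (t.linst u).sub σ s = (t.sub σ (.term .svar)).linst (u.sub σ s) := by
  rw [Tm.sub_linst, Tm.linst, Tm.sub_sub]
  rfl

theorem Tm.linst_linst {C D : CTy V W} (t : Tm Γ (some D) A) (u : Tm Γ (some C) (.comp D))
    (r : Tm Γ Δ (.comp C)) : (t.linst u).linst r = t.linst (u.linst r) := by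
  rw [Tm.linst, Tm.linst_sub, Tm.sub_id_svar]
  rfl

theorem Tm.wk_sub_lift_empty (t : Tm Γ none A) (σ : VSub Γ Γ') (B : VTy V W) :
    (t.wk B).sub (σ.lift B) .empty = (t.sub σ .empty).wk B :=
  t.wk_sub_lift σ .empty B

theorem Tm.wk_sub_lift_svar {D : CTy V W} (t : Tm Γ (some D) A) (σ : VSub Γ Γ') (B : VTy V W) :
    (t.wk B).sub (σ.lift B) (.term .svar) = (t.sub σ (.term .svar)).wk B :=
  t.wk_sub_lift σ (.term .svar) B

theorem Tm.wk_inst (t : Tm Γ Δ A) (u : Tm Γ none B) : (t.wk B).inst u = t := by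
  rw [Tm.inst, VSub.single_eq_cons, Tm.wk_sub_cons, Tm.sub_id]

theorem Tm.closed_ren (t : Tm ([] : Ctx V W) none A) (ρ : Ren Γ Γ') :
    (t.closed Γ).ren ρ = t.closed Γ' := by
  rw [Tm.closed, Tm.ren_ren]
  congr 1
  funext A x
  cases x

theorem Tm.closed_sub (t : Tm ([] : Ctx V W) none A) (σ : VSub Γ Γ') :
    (t.closed Γ).sub σ .empty = t.closed Γ' := by
  rw [Tm.closed, Tm.ren_sub, Tm.closed, Tm.ren_eq_sub]
  congr 1
  funext A x
  cases x

theorem Tm.closed_nil (t : Tm ([] : Ctx V W) none A) : t.closed [] = t := by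
  rw [Tm.closed, Tm.ren_eq_sub]
  refine Eq.trans ?_ t.sub_id
  congr 1
  funext A x
  cases x

end Syntactic

/-! ## Equality is preserved by substitution -/

section Substitution

variable {Γ Γ' : Ctx V W} {Δ Δ' : Stoup V W} {A B : VTy V W}

theorem Eqv.of_eq {t u : Tm Γ Δ A} (h : t = u) : Eqv t u := h ▸ .refl t

theorem Eqv.sub {t t' : Tm Γ Δ A} (h : Eqv t t') (σ : VSub Γ Γ') (s : SSub Γ' Δ Δ') :
    Eqv (t.sub σ s) (t'.sub σ s) := by
  induction h generalizing Γ' Δ' with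
  | refl t => exact .refl _
  | symm _ ih => exact (ih σ s).symm
  | trans _ _ ih ih' => exact (ih σ s).trans (ih' σ s)
  | pair _ _ ih ih' => cases s; exact .pair (ih _ _) (ih' _ _)
  | fst _ ih => cases s; exact .fst (ih _ _)
  | snd _ ih => cases s; exact .snd (ih _ _)
  | lam _ ih => cases s; exact .lam (ih _ _)
  | app _ _ ih ih' => cases s; exact .app (ih _ _) (ih' _ _)
  | cpair _ _ ih ih' => exact .cpair (ih _ _) (ih' _ _)
  | cfst _ ih => exact .cfst (ih _ _)
  | csnd _ ih => exact .csnd (ih _ _)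
  | clam _ ih => exact .clam (ih _ _)
  | capp _ _ ih ih' => exact .capp (ih _ _) (ih' _ _)
  | ilet _ _ ih ih' => exact .ilet (ih _ _) (ih' _ _)
  | bang _ ih => cases s; exact .bang (ih _ _)
  | blet _ _ ih ih' => exact .blet (ih _ _) (ih' _ _)
  | ten _ _ ih ih' => exact .ten (ih _ _) (ih' _ _)
  | tlet _ _ ih ih' => exact .tlet (ih _ _) (ih' _ _)
  | image _ ih => exact .image (ih _ _)
  | inl _ ih => exact .inl (ih _ _)
  | inr _ ih => exact .inr (ih _ _)
  | cases _ _ _ ih ih' ih'' => exact .cases (ih _ _) (ih' _ _) (ih'' _ _)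
  | llam _ ih => cases s; exact .llam (ih _ _)
  | lapp _ _ ih ih' => exact .lapp (ih _ _) (ih' _ _)
  | one_eta t => cases s; exact .one_eta _
  | fst_beta t u => cases s; exact .fst_beta _ _
  | snd_beta t u => cases s; exact .snd_beta _ _
  | prod_eta t => cases s; exact .prod_eta _
  | arr_beta t u => cases s; rw [Tm.inst_sub]; exact .arr_beta _ _
  | arr_eta t =>
    cases s
    simp only [Tm.sub, Tm.wk_sub_lift_empty]
    exact .arr_eta _
  | cone_eta t => exact .cone_eta _
  | cfst_beta t u => exact .cfst_beta _ _
  | csnd_beta t u => exact .csnd_beta _ _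
  | amp_eta t => exact .amp_eta _
  | pow_beta t u => rw [Tm.inst_sub]; exact .pow_beta _ _
  | pow_eta t =>
    simp only [Tm.sub, Tm.wk_sub_lift]
    exact .pow_eta _
  | I_beta t => cases s; exact .I_beta _
  | I_eta t u =>
    simp only [Tm.sub, Tm.linst_sub]
    exact .I_eta _ _
  | bang_beta t u => cases s; rw [Tm.inst_sub]; exact .bang_beta _ _
  | bang_eta t u =>
    simp only [Tm.sub, Tm.linst_sub, Tm.wk_sub_lift_svar]
    exact .bang_eta _ _
  | copow_beta t r u =>
    have h : (u.sub (.single t) (.term r)).sub σ s =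
        (u.sub (σ.lift _) (.term .svar)).sub (.single (t.sub σ .empty)) (.term (r.sub σ s)) := by
      rw [Tm.sub_sub, Tm.sub_sub, VSub.single_eq_cons, VSub.cons_comp, VSub.id_comp,
        VSub.single_eq_cons, VSub.lift_comp_cons, VSub.comp_id]
      rfl
    rw [h]
    exact .copow_beta _ _ _
  | copow_eta t u =>
    simp only [Tm.sub, Tm.linst_sub, Tm.wk_sub_lift_svar]
    exact .copow_eta _ _
  | zero_eta t u => rw [Tm.linst_sub]; exact .zero_eta _ _
  | inl_beta t u u' => rw [Tm.linst_sub]; exact .inl_beta _ _ _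
  | inr_beta t u u' => rw [Tm.linst_sub]; exact .inr_beta _ _ _
  | plus_eta t u =>
    simp only [Tm.sub, Tm.linst_sub]
    exact .plus_eta _ _
  | lolli_beta t u => rw [Tm.linst_sub]; exact .lolli_beta _ _
  | lolli_eta t => cases s; exact .lolli_eta _

theorem Eqv.wk {t t' : Tm Γ Δ A} (h : Eqv t t') (B : VTy V W) : Eqv (t.wk B) (t'.wk B) := by
  rw [Tm.wk, Tm.wk, Tm.ren_eq_sub, Tm.ren_eq_sub]
  exact h.sub _ _

/-- Pointwise equality of substitutions for the context. -/
def VSub.Eqv (σ τ : VSub Γ Γ') : Prop := ∀ A x, EEC.Eqv (σ A x) (τ A x)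

/-- Equality of substitutions for the stoup. -/
inductive SSub.Eqv : {Δ Δ' : Stoup V W} → SSub Γ Δ Δ' → SSub Γ Δ Δ' → Prop
  | empty : SSub.Eqv .empty .empty
  | term {D : CTy V W} {Δ' : Stoup V W} {u u' : Tm Γ Δ' (.comp D)} :
      EEC.Eqv u u' → SSub.Eqv (.term u) (.term u')

theorem VSub.Eqv.refl (σ : VSub Γ Γ') : σ.Eqv σ := fun _ _ => .refl _

theorem VSub.Eqv.lift {σ σ' : VSub Γ Γ'} (h : σ.Eqv σ') (B : VTy V W) :
    (σ.lift B).Eqv (σ'.lift B)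
  | _, .zero => .refl _
  | _, .succ x => (h _ x).wk B

theorem SSub.Eqv.refl (s : SSub Γ Δ Δ') : s.Eqv s := by
  cases s
  · exact .empty
  · exact .term (.refl _)

theorem SSub.Eqv.wk {s s' : SSub Γ Δ Δ'} (h : s.Eqv s') (B : VTy V W) :
    (s.wk B).Eqv (s'.wk B) := by
  cases h with
  | empty => exact .empty
  | term h => exact .term (h.wk B)

theorem Tm.sub_congr (t : Tm Γ Δ A) {σ σ' : VSub Γ Γ'} (h : σ.Eqv σ') {s s' : SSub Γ' Δ Δ'}
    (hs : s.Eqv s') : Eqv (t.sub σ s) (t.sub σ' s') := by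
  induction t generalizing Γ' Δ' with
  | var x => cases hs; exact h _ _
  | star => cases hs; exact .refl _
  | pair t u iht ihu => cases hs; exact .pair (iht h .empty) (ihu h .empty)
  | fst t ih => cases hs; exact .fst (ih h .empty)
  | snd t ih => cases hs; exact .snd (ih h .empty)
  | lam t ih => cases hs; exact .lam (ih (h.lift _) .empty)
  | app t u iht ihu => cases hs; exact .app (iht h .empty) (ihu h .empty)
  | svar => cases hs with | term hs => exact hs
  | cstar => exact .cone_eta _
  | cpair t u iht ihu => exact .cpair (iht h hs) (ihu h hs)
  | cfst t ih => exact .cfst (ih h hs)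
  | csnd t ih => exact .csnd (ih h hs)
  | clam t ih => exact .clam (ih (h.lift _) (hs.wk _))
  | capp t u iht ihu => exact .capp (iht h hs) (ihu h .empty)
  | top => cases hs; exact .refl _
  | ilet t u iht ihu => exact .ilet (iht h hs) (ihu h .empty)
  | bang t ih => cases hs; exact .bang (ih h .empty)
  | blet t u iht ihu => exact .blet (iht h hs) (ihu (h.lift _) .empty)
  | ten t u iht ihu => exact .ten (iht h .empty) (ihu h hs)
  | tlet r t ihr iht => exact .tlet (ihr h hs) (iht (h.lift _) (.refl _))
  | image t ih => exact .image (ih h hs)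
  | inl t ih => exact .inl (ih h hs)
  | inr t ih => exact .inr (ih h hs)
  | cases r t u ihr iht ihu => exact .cases (ihr h hs) (iht h (.refl _)) (ihu h (.refl _))
  | llam t ih => cases hs; exact .llam (ih h (.refl _))
  | lapp r t ihr iht => exact .lapp (ihr h .empty) (iht h hs)

theorem Eqv.linst {D : CTy V W} {t t' : Tm Γ (some D) A} (h : Eqv t t') {u u' : Tm Γ Δ (.comp D)}
    (hu : Eqv u u') : Eqv (t.linst u) (t'.linst u') :=
  (h.sub _ _).trans (t'.sub_congr (.refl _) (.term hu))

end Substitution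

/-! ## Extensionality and commuting conversions -/

section Conversions

variable {Γ Γ' : Ctx V W} {Δ Δ' : Stoup V W} {A : VTy V W} {B C D E : CTy V W}

theorem Tm.wk_linst {A' : VTy V W} (t : Tm Γ (some D) A') (u : Tm Γ Δ (.comp D)) (B : VTy V W) :
    (t.linst u).wk B = (t.wk B).linst (u.wk B) := by
  rw [Tm.linst, Tm.linst, Tm.wk_sub, Tm.wk, Tm.sub_ren]
  rfl

theorem Eqv.linst_right {A' : VTy V W} (t : Tm Γ (some D) A') {u u' : Tm Γ Δ (.comp D)}
    (hu : Eqv u u') : Eqv (t.linst u) (t.linst u') :=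
  Eqv.linst (.refl t) hu

theorem Eqv.I_ext {v w : Tm Γ (some .I) (.comp C)} (h : Eqv (v.linst .top) (w.linst .top)) :
    Eqv v w := by
  have hv := Eqv.I_eta .svar v
  have hw := Eqv.I_eta .svar w
  rw [Tm.linst_svar] at hv hw
  exact hv.symm.trans ((Eqv.ilet (.refl _) h).trans hw)

theorem Eqv.bang_ext {v w : Tm Γ (some (.bang A)) (.comp C)}
    (h : Eqv ((v.wk A).linst (.bang (.var .zero))) ((w.wk A).linst (.bang (.var .zero)))) :
    Eqv v w := by
  have hv := Eqv.bang_eta .svar v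
  have hw := Eqv.bang_eta .svar w
  rw [Tm.linst_svar] at hv hw
  exact hv.symm.trans ((Eqv.blet (.refl _) h).trans hw)

theorem Eqv.copow_ext {v w : Tm Γ (some (.copow A B)) (.comp C)}
    (h : Eqv ((v.wk A).linst (.ten (.var .zero) .svar))
      ((w.wk A).linst (.ten (.var .zero) .svar))) : Eqv v w := by
  have hv := Eqv.copow_eta .svar v
  have hw := Eqv.copow_eta .svar w
  rw [Tm.linst_svar] at hv hw
  exact hv.symm.trans ((Eqv.tlet (.refl _) h).trans hw)

theorem Eqv.plus_ext {v w : Tm Γ (some (.plus B C)) (.comp D)}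
    (hl : Eqv (v.linst (.inl .svar)) (w.linst (.inl .svar)))
    (hr : Eqv (v.linst (.inr .svar)) (w.linst (.inr .svar))) : Eqv v w := by
  have hv := Eqv.plus_eta .svar v
  have hw := Eqv.plus_eta .svar w
  rw [Tm.linst_svar] at hv hw
  exact hv.symm.trans ((Eqv.cases (.refl _) hl hr).trans hw)

theorem Tm.ren_lift_inst_zero {A' : VTy V W} (t : Tm (A :: Γ) Δ A') :
    (t.ren (Ren.lift (fun _ x => .succ x) A)).inst (.var .zero) = t := by
  rw [Tm.inst, Tm.ren_sub]
  refine Eq.trans ?_ t.sub_id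
  congr 1
  funext _ x
  cases x <;> rfl

theorem Tm.ren_lift_sub_single_zero {A' : VTy V W} (t : Tm (A :: Γ) (some B) A') :
    (t.ren (Ren.lift (fun _ x => .succ x) A)).sub (.single (.var .zero)) (.term .svar) = t :=
  t.ren_lift_inst_zero

theorem Eqv.linst_ilet (v : Tm Γ (some D) (.comp C)) (t : Tm Γ Δ (.comp .I))
    (u : Tm Γ none (.comp D)) : Eqv (v.linst (.ilet t u)) (.ilet t (v.linst u)) := by
  have key : Eqv (v.linst (.ilet .svar u)) (.ilet .svar (v.linst u)) := by
    refine .I_ext ?_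
    rw [Tm.linst_linst]
    refine Eqv.trans ?_ (Eqv.I_beta _).symm
    rw [Tm.sub_id_empty]
    refine .linst_right _ ((Eqv.I_beta _).trans (.of_eq u.sub_id_empty))
  have := Eqv.linst key (.refl t)
  rw [Tm.linst_linst] at this
  simpa only [Tm.linst, Tm.sub, Tm.sub_id_empty] using this

theorem Eqv.linst_blet (v : Tm Γ (some D) (.comp C)) (t : Tm Γ Δ (.comp (.bang A)))
    (u : Tm (A :: Γ) none (.comp D)) :
    Eqv (v.linst (.blet t u)) (.blet t ((v.wk A).linst u)) := by
  have h := Eqv.bang_eta t (v.linst (.blet .svar u))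
  rw [Tm.linst_linst, Tm.wk_linst, Tm.linst_linst] at h
  have hr : (Tm.blet .svar u).linst t = .blet t u := by
    simp only [Tm.linst, Tm.sub, VSub.id_lift, Tm.sub_id_empty]
  have hl : Eqv (((Tm.blet .svar u).wk A).linst (.bang (.var .zero))) u := by
    simp only [Tm.linst, Tm.wk, Tm.ren, Tm.sub, VSub.id_lift, Tm.sub_id_empty]
    exact (Eqv.bang_beta _ _).trans (.of_eq u.ren_lift_inst_zero)
  rw [hr] at h
  exact h.symm.trans (.blet (.refl _) (.linst_right _ hl))

theorem Eqv.linst_tlet (v : Tm Γ (some D) (.comp C)) (t : Tm Γ Δ (.comp (.copow A B)))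
    (u : Tm (A :: Γ) (some B) (.comp D)) :
    Eqv (v.linst (.tlet t u)) (.tlet t ((v.wk A).linst u)) := by
  have h := Eqv.copow_eta t (v.linst (.tlet .svar u))
  rw [Tm.linst_linst, Tm.wk_linst, Tm.linst_linst] at h
  have hr : (Tm.tlet .svar u).linst t = .tlet t u := by
    simp only [Tm.linst, Tm.sub, VSub.id_lift, Tm.sub_id_svar]
  have hl : Eqv (((Tm.tlet .svar u).wk A).linst (.ten (.var .zero) .svar)) u := by
    simp only [Tm.linst, Tm.wk, Tm.ren, Tm.sub, VSub.id_lift, Tm.sub_id_svar]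
    exact (Eqv.copow_beta _ _ _).trans (.of_eq u.ren_lift_sub_single_zero)
  rw [hr] at h
  exact h.symm.trans (.tlet (.refl _) (.linst_right _ hl))

theorem Eqv.linst_image (v : Tm Γ (some D) (.comp C)) (t : Tm Γ Δ (.comp .zero)) :
    Eqv (v.linst (.image t)) (.image t) := by
  have h := Eqv.zero_eta t (v.linst (.image .svar))
  rw [Tm.linst_linst] at h
  exact h.symm

theorem Eqv.linst_cases (v : Tm Γ (some D) (.comp E)) (s : Tm Γ Δ (.comp (.plus B C)))
    (t : Tm Γ (some B) (.comp D)) (u : Tm Γ (some C) (.comp D)) :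
    Eqv (v.linst (.cases s t u)) (.cases s (v.linst t) (v.linst u)) := by
  have h := Eqv.plus_eta s (v.linst (.cases .svar t u))
  rw [Tm.linst_linst, Tm.linst_linst, Tm.linst_linst] at h
  have hs : ∀ {Δ : Stoup V W} (s : Tm Γ Δ (.comp (.plus B C))),
      (Tm.cases .svar t u).linst s = .cases s t u := by
    intro _ s
    simp only [Tm.linst, Tm.sub, Tm.sub_id_svar]
  rw [hs, hs, hs] at h
  refine h.symm.trans (.cases (.refl _) (.linst_right _ ?_) (.linst_right _ ?_))
  · exact (Eqv.inl_beta _ _ _).trans (.of_eq t.linst_svar)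
  · exact (Eqv.inr_beta _ _ _).trans (.of_eq u.linst_svar)

theorem Tm.lapp_eq_linst (f : Tm Γ none (.lolli B C)) (t : Tm Γ Δ (.comp B)) :
    Tm.lapp f t = (Tm.lapp f .svar).linst t := by
  simp only [Tm.linst, Tm.sub, Tm.sub_id_empty]

/-! ## Transport along identities between computation types -/

/-- A term, along an identity between computation types. -/
def Tm.castC (h : B = C) (t : Tm Γ Δ (.comp B)) : Tm Γ Δ (.comp C) := h ▸ t

theorem Tm.castC_castC (h : B = C) (h' : C = B) (t : Tm Γ Δ (.comp B)) :
    (t.castC h).castC h' = t := by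
  subst h
  rfl

theorem Tm.svarEq_sub (h : B = C) (σ : VSub Γ Γ') (t : Tm Γ' Δ (.comp B)) :
    (Tm.svarEq h).sub σ (.term t) = t.castC h := by
  subst h
  rfl

theorem Tm.topEq_eq_castC (h : B = .I) : (Tm.topEq h : Tm Γ none _) = Tm.top.castC h.symm := by
  subst h
  rfl

theorem Tm.topEq_sub (h : B = .I) (σ : VSub Γ Γ') :
    (Tm.topEq h).sub σ .empty = Tm.topEq h := by
  subst h
  rfl

theorem Tm.topEq_wk (h : B = .I) (A : VTy V W) :
    (Tm.topEq h : Tm Γ none _).wk A = Tm.topEq h := by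
  subst h
  rfl

theorem Eqv.castC (h : B = C) {t u : Tm Γ Δ (.comp B)} (htu : Eqv t u) :
    Eqv (t.castC h) (u.castC h) := by
  subst h
  exact htu

theorem Eqv.ilet_topEq (h : B = .I) (t : Tm Γ none (.comp C)) :
    Eqv (.ilet ((Tm.topEq h).castC h) t) t := by
  subst h
  exact .I_beta t

theorem Eqv.ilet_castC_eta (h : B = .I) (t : Tm Γ Δ (.comp B)) (u : Tm Γ (some B) (.comp C)) :
    Eqv (.ilet (t.castC h) (u.linst (.topEq h))) (u.linst t) := by
  subst h
  exact .I_eta t u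

end Conversions

/-! ## The type isomorphisms as operations on terms -/

/-- The empty substitution. -/
def VSub.nil (Γ : Ctx V W) : VSub ([] : Ctx V W) Γ := fun _ x => nomatch x

section Iso

variable {R : CTy V W} (hR : R.IsConstOrI) {Γ Γ' : Ctx V W} {Δ Δ' : Stoup V W}

/-- `ϑ_A(t)` -/
noncomputable def fromVV (A : VTy V W) (t : Tm Γ none (vtr R (vtr R A))) : Tm Γ none A :=
  .app ((viso hR A).closed Γ) t

/-- `ϑ_A⁻¹(t)` -/
noncomputable def toVV (A : VTy V W) (t : Tm Γ none A) : Tm Γ none (vtr R (vtr R A)) :=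
  .app ((visoInv hR A).closed Γ) t

/-- `ϑ_A[t]` for a computation type `A` -/
noncomputable def fromCC (A : CTy V W) (t : Tm Γ Δ (.comp (ctr R (ctr R A)))) :
    Tm Γ Δ (.comp A) :=
  .lapp ((ciso hR A).closed Γ) t

/-- `ϑ_A⁻¹[t]` for a computation type `A` -/
noncomputable def toCC (A : CTy V W) (t : Tm Γ Δ (.comp A)) :
    Tm Γ Δ (.comp (ctr R (ctr R A))) :=
  .lapp ((cisoInv hR A).closed Γ) t

section Syntactic

theorem fromVV_sub (A : VTy V W) (t : Tm Γ none (vtr R (vtr R A))) (σ : VSub Γ Γ') :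
    (fromVV hR A t).sub σ .empty = fromVV hR A (t.sub σ .empty) := by
  simp only [fromVV, Tm.sub, Tm.closed_sub]

theorem toVV_sub (A : VTy V W) (t : Tm Γ none A) (σ : VSub Γ Γ') :
    (toVV hR A t).sub σ .empty = toVV hR A (t.sub σ .empty) := by
  simp only [toVV, Tm.sub, Tm.closed_sub]

theorem fromCC_sub (A : CTy V W) (t : Tm Γ Δ (.comp (ctr R (ctr R A)))) (σ : VSub Γ Γ')
    (s : SSub Γ' Δ Δ') : (fromCC hR A t).sub σ s = fromCC hR A (t.sub σ s) := by
  simp only [fromCC, Tm.sub, Tm.closed_sub]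

theorem toCC_sub (A : CTy V W) (t : Tm Γ Δ (.comp A)) (σ : VSub Γ Γ')
    (s : SSub Γ' Δ Δ') : (toCC hR A t).sub σ s = toCC hR A (t.sub σ s) := by
  simp only [toCC, Tm.sub, Tm.closed_sub]

theorem fromVV_wk (A B : VTy V W) (t : Tm Γ none (vtr R (vtr R A))) :
    (fromVV hR A t).wk B = fromVV hR A (t.wk B) := by
  simp only [fromVV, Tm.wk, Tm.ren, Tm.closed_ren]

theorem toVV_wk (A B : VTy V W) (t : Tm Γ none A) :
    (toVV hR A t).wk B = toVV hR A (t.wk B) := by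
  simp only [toVV, Tm.wk, Tm.ren, Tm.closed_ren]

theorem fromCC_wk (A : CTy V W) (B : VTy V W) (t : Tm Γ Δ (.comp (ctr R (ctr R A)))) :
    (fromCC hR A t).wk B = fromCC hR A (t.wk B) := by
  simp only [fromCC, Tm.wk, Tm.ren, Tm.closed_ren]

theorem toCC_wk (A : CTy V W) (B : VTy V W) (t : Tm Γ Δ (.comp A)) :
    (toCC hR A t).wk B = toCC hR A (t.wk B) := by
  simp only [toCC, Tm.wk, Tm.ren, Tm.closed_ren]

theorem fromCC_linst (A D : CTy V W) (t : Tm Γ (some D) (.comp (ctr R (ctr R A))))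
    (u : Tm Γ Δ (.comp D)) : (fromCC hR A t).linst u = fromCC hR A (t.linst u) :=
  fromCC_sub hR A t _ _

theorem toCC_linst (A D : CTy V W) (t : Tm Γ (some D) (.comp A))
    (u : Tm Γ Δ (.comp D)) : (toCC hR A t).linst u = toCC hR A (t.linst u) :=
  toCC_sub hR A t _ _

end Syntactic

theorem Eqv.fromVV (A : VTy V W) {t t' : Tm Γ none (vtr R (vtr R A))} (h : Eqv t t') :
    Eqv (fromVV hR A t) (EEC.fromVV hR A t') := .app (.refl _) h

theorem Eqv.toVV (A : VTy V W) {t t' : Tm Γ none A} (h : Eqv t t') :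
    Eqv (toVV hR A t) (EEC.toVV hR A t') := .app (.refl _) h

theorem Eqv.fromCC (A : CTy V W) {t t' : Tm Γ Δ (.comp (ctr R (ctr R A)))} (h : Eqv t t') :
    Eqv (fromCC hR A t) (EEC.fromCC hR A t') := .lapp (.refl _) h

theorem Eqv.toCC (A : CTy V W) {t t' : Tm Γ Δ (.comp A)} (h : Eqv t t') :
    Eqv (toCC hR A t) (EEC.toCC hR A t') := .lapp (.refl _) h

theorem Eqv.closed_lam_beta {A B : VTy V W} (b : Tm [A] none B) (t : Tm Γ none A) :
    Eqv (.app ((Tm.lam b).closed Γ) t) (b.sub (.cons t (.nil Γ)) .empty) := by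
  refine (Eqv.arr_beta _ _).trans (.of_eq ?_)
  rw [Tm.inst, Tm.ren_sub]
  congr 1
  funext A x
  cases x with
  | zero => rfl
  | succ x => cases x

theorem Eqv.closed_llam_beta {A B : CTy V W} (b : Tm [] (some A) (.comp B))
    (t : Tm Γ Δ (.comp A)) :
    Eqv (.lapp ((Tm.llam b).closed Γ) t) (b.sub (.nil Γ) (.term t)) := by
  refine (Eqv.lolli_beta _ _).trans (.of_eq ?_)
  rw [Tm.linst, Tm.ren_sub]
  congr 1
  funext A x
  cases x

section Clauses

variable {A B : VTy V W} {C D : CTy V W}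

theorem fromVV_const (a : V) (t : Tm Γ none (.const a)) :
    Eqv (fromVV hR (.const a) t) t := .closed_lam_beta _ _

theorem toVV_const (a : V) (t : Tm Γ none (.const a)) :
    Eqv (toVV hR (.const a) t) t := .closed_lam_beta _ _

theorem fromVV_prod (t : Tm Γ none (.prod (vtr R (vtr R A)) (vtr R (vtr R B)))) :
    Eqv (fromVV hR (.prod A B) t) (.pair (fromVV hR A (.fst t)) (fromVV hR B (.snd t))) := by
  refine (Eqv.closed_lam_beta (A := .prod (vtr R (vtr R A)) (vtr R (vtr R B))) _ _).trans
    (.of_eq ?_)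
  simp only [Tm.sub, Tm.closed_sub]
  rfl

theorem toVV_prod (t : Tm Γ none (.prod A B)) :
    Eqv (toVV hR (.prod A B) t)
      (.pair (A := vtr R (vtr R A)) (B := vtr R (vtr R B))
        (toVV hR A (.fst t)) (toVV hR B (.snd t))) := by
  refine (Eqv.closed_lam_beta _ _).trans (.of_eq ?_)
  simp only [Tm.sub, Tm.closed_sub]
  rfl

theorem fromVV_arr (t : Tm Γ none (.arr (vtr R (vtr R A)) (vtr R (vtr R B)))) :
    Eqv (fromVV hR (.arr A B) t)
      (.lam (fromVV hR B (.app (t.wk A) (toVV hR A (.var .zero))))) := by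
  refine (Eqv.closed_lam_beta (A := .arr (vtr R (vtr R A)) (vtr R (vtr R B))) _ _).trans (.of_eq ?_)
  simp only [Tm.sub, Tm.closed_sub]
  rfl

theorem toVV_arr (t : Tm Γ none (.arr A B)) :
    Eqv (toVV hR (.arr A B) t)
      (.lam (A := vtr R (vtr R A)) (B := vtr R (vtr R B))
        (toVV hR B (.app (t.wk _) (fromVV hR A (.var .zero))))) := by
  refine (Eqv.closed_lam_beta _ _).trans (.of_eq ?_)
  simp only [Tm.sub, Tm.closed_sub]
  rfl

theorem fromVV_comp (t : Tm Γ none (.lolli (ctr R R) (ctr R (ctr R C)))) :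
    Eqv (fromVV hR (.comp C) t) (fromCC hR C (.lapp t (.topEq hR.tr_self))) := by
  refine (Eqv.closed_lam_beta (A := .lolli (ctr R R) (ctr R (ctr R C))) _ _).trans (.of_eq ?_)
  simp only [Tm.sub, Tm.closed_sub, Tm.topEq_sub]
  rfl

theorem toVV_comp (t : Tm Γ none (.comp C)) :
    Eqv (toVV hR (.comp C) t)
      (.llam (A := ctr R R) (B := ctr R (ctr R C))
        (.ilet (Tm.svar.castC hR.tr_self) (toCC hR C t))) := by
  refine (Eqv.closed_lam_beta _ _).trans (.of_eq ?_)
  simp only [Tm.sub, Tm.closed_sub, Tm.svarEq_sub]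
  rfl

theorem fromVV_lolli (t : Tm Γ none (.lolli (ctr R (ctr R C)) (ctr R (ctr R D)))) :
    Eqv (fromVV hR (.lolli C D) t) (.llam (fromCC hR D (.lapp t (toCC hR C .svar)))) := by
  refine (Eqv.closed_lam_beta (A := .lolli (ctr R (ctr R C)) (ctr R (ctr R D))) _ _).trans
    (.of_eq ?_)
  simp only [Tm.sub, Tm.closed_sub]
  rfl

theorem toVV_lolli (t : Tm Γ none (.lolli C D)) :
    Eqv (toVV hR (.lolli C D) t)
      (.llam (A := ctr R (ctr R C)) (B := ctr R (ctr R D))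
        (toCC hR D (.lapp t (fromCC hR C .svar)))) := by
  refine (Eqv.closed_lam_beta _ _).trans (.of_eq ?_)
  simp only [Tm.sub, Tm.closed_sub]
  rfl

theorem fromCC_const (a : W) (t : Tm Γ Δ (.comp (ctr R (ctr R (.const a))))) :
    Eqv (fromCC hR (.const a) t) (t.castC (hR.tr_tr_const a)) :=
  (Eqv.closed_llam_beta _ _).trans (.of_eq (Tm.svarEq_sub _ _ _))

theorem toCC_const (a : W) (t : Tm Γ Δ (.comp (.const a))) :
    Eqv (toCC hR (.const a) t) (t.castC (hR.tr_tr_const a).symm) :=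
  (Eqv.closed_llam_beta _ _).trans (.of_eq (Tm.svarEq_sub _ _ _))

theorem fromCC_amp (t : Tm Γ Δ (.comp (.amp (ctr R (ctr R C)) (ctr R (ctr R D))))) :
    Eqv (fromCC hR (.amp C D) t)
      (.cpair (fromCC hR C (.cfst t)) (fromCC hR D (.csnd t))) := by
  refine (Eqv.closed_llam_beta _ _).trans (.of_eq ?_)
  simp only [Tm.sub, Tm.closed_sub]
  rfl

theorem toCC_amp (t : Tm Γ Δ (.comp (.amp C D))) :
    Eqv (toCC hR (.amp C D) t)
      (.cpair (A := ctr R (ctr R C)) (B := ctr R (ctr R D))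
        (toCC hR C (.cfst t)) (toCC hR D (.csnd t))) := by
  refine (Eqv.closed_llam_beta _ _).trans (.of_eq ?_)
  simp only [Tm.sub, Tm.closed_sub]
  rfl

theorem fromCC_pow (t : Tm Γ Δ (.comp (.pow (vtr R (vtr R A)) (ctr R (ctr R D))))) :
    Eqv (fromCC hR (.pow A D) t)
      (.clam (fromCC hR D (.capp (t.wk A) (toVV hR A (.var .zero))))) := by
  refine (Eqv.closed_llam_beta _ _).trans (.of_eq ?_)
  simp only [Tm.sub, Tm.closed_sub]
  rfl

theorem toCC_pow (t : Tm Γ Δ (.comp (.pow A D))) :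
    Eqv (toCC hR (.pow A D) t)
      (.clam (A := vtr R (vtr R A)) (B := ctr R (ctr R D))
        (toCC hR D (.capp (t.wk _) (fromVV hR A (.var .zero))))) := by
  refine (Eqv.closed_llam_beta _ _).trans (.of_eq ?_)
  simp only [Tm.sub, Tm.closed_sub]
  rfl

theorem fromCC_I (t : Tm Γ Δ (.comp (ctr R R))) :
    Eqv (fromCC hR .I t) (t.castC hR.tr_self) :=
  (Eqv.closed_llam_beta _ _).trans (.of_eq (Tm.svarEq_sub _ _ _))

theorem toCC_I (t : Tm Γ Δ (.comp .I)) :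
    Eqv (toCC hR .I t) (t.castC (C := ctr R R) hR.tr_self.symm) :=
  (Eqv.closed_llam_beta _ _).trans (.of_eq (Tm.svarEq_sub _ _ _))

theorem fromCC_bang (t : Tm Γ Δ (.comp (.copow (vtr R (vtr R A)) (ctr R R)))) :
    Eqv (fromCC hR (.bang A) t)
      (.tlet t (.ilet (Tm.svar.castC hR.tr_self) (.bang (fromVV hR A (.var .zero))))) := by
  refine (Eqv.closed_llam_beta _ _).trans (.of_eq ?_)
  simp only [Tm.sub, Tm.closed_sub, Tm.svarEq_sub]
  rfl

theorem toCC_bang (t : Tm Γ Δ (.comp (.bang A))) :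
    Eqv (toCC hR (.bang A) t)
      (.blet (B := .copow (vtr R (vtr R A)) (ctr R R)) t
        (.ten (toVV hR A (.var .zero)) (.topEq hR.tr_self))) := by
  refine (Eqv.closed_llam_beta _ _).trans (.of_eq ?_)
  simp only [Tm.sub, Tm.closed_sub, Tm.topEq_sub]
  rfl

theorem fromCC_copow (t : Tm Γ Δ (.comp (.copow (vtr R (vtr R A)) (ctr R (ctr R D))))) :
    Eqv (fromCC hR (.copow A D) t)
      (.tlet t (.ten (fromVV hR A (.var .zero)) (fromCC hR D .svar))) := by
  refine (Eqv.closed_llam_beta _ _).trans (.of_eq ?_)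
  simp only [Tm.sub, Tm.closed_sub]
  rfl

theorem toCC_copow (t : Tm Γ Δ (.comp (.copow A D))) :
    Eqv (toCC hR (.copow A D) t)
      (.tlet (C := .copow (vtr R (vtr R A)) (ctr R (ctr R D))) t
        (.ten (toVV hR A (.var .zero)) (toCC hR D .svar))) := by
  refine (Eqv.closed_llam_beta _ _).trans (.of_eq ?_)
  simp only [Tm.sub, Tm.closed_sub]
  rfl

theorem fromCC_zero (t : Tm Γ Δ (.comp .zero)) : Eqv (fromCC hR .zero t) t :=
  .closed_llam_beta _ _

theorem toCC_zero (t : Tm Γ Δ (.comp .zero)) : Eqv (toCC hR .zero t) t :=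
  .closed_llam_beta _ _

theorem fromCC_plus (t : Tm Γ Δ (.comp (.plus (ctr R (ctr R C)) (ctr R (ctr R D))))) :
    Eqv (fromCC hR (.plus C D) t)
      (.cases t (.inl (fromCC hR C .svar)) (.inr (fromCC hR D .svar))) := by
  refine (Eqv.closed_llam_beta _ _).trans (.of_eq ?_)
  simp only [Tm.sub, Tm.closed_sub]
  rfl

theorem toCC_plus (t : Tm Γ Δ (.comp (.plus C D))) :
    Eqv (toCC hR (.plus C D) t)
      (.cases (C := .plus (ctr R (ctr R C)) (ctr R (ctr R D))) t
        (.inl (toCC hR C .svar)) (.inr (toCC hR D .svar))) := by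
  refine (Eqv.closed_llam_beta _ _).trans (.of_eq ?_)
  simp only [Tm.sub, Tm.closed_sub]
  rfl

end Clauses
end Iso

section Iso

variable {R : CTy V W} (hR : R.IsConstOrI) {Γ Γ' : Ctx V W} {Δ Δ' : Stoup V W}

theorem Tm.wk_sub_single {A B : VTy V W} (t : Tm Γ none A) (u : Tm Γ none B) :
    (t.wk B).sub (.single u) .empty = t := t.wk_inst u

theorem Tm.wk_sub_single_id {A B : VTy V W} (t : Tm Γ Δ A) (u : Tm Γ none B) :
    (t.wk B).sub (.single u) (.id Γ Δ) = t := t.wk_inst u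

section Elimination

variable {A B : VTy V W} {C D : CTy V W}

theorem fst_fromVV (t : Tm Γ none (.prod (vtr R (vtr R A)) (vtr R (vtr R B)))) :
    Eqv (.fst (fromVV hR (.prod A B) t)) (fromVV hR A (.fst t)) :=
  (Eqv.fst (fromVV_prod hR t)).trans (.fst_beta _ _)

theorem snd_fromVV (t : Tm Γ none (.prod (vtr R (vtr R A)) (vtr R (vtr R B)))) :
    Eqv (.snd (fromVV hR (.prod A B) t)) (fromVV hR B (.snd t)) :=
  (Eqv.snd (fromVV_prod hR t)).trans (.snd_beta _ _)

theorem fst_toVV (t : Tm Γ none (.prod A B)) :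
    Eqv (.fst (A := vtr R (vtr R A)) (B := vtr R (vtr R B)) (toVV hR (.prod A B) t))
      (toVV hR A (.fst t)) :=
  (Eqv.fst (toVV_prod hR t)).trans (.fst_beta _ _)

theorem snd_toVV (t : Tm Γ none (.prod A B)) :
    Eqv (.snd (A := vtr R (vtr R A)) (B := vtr R (vtr R B)) (toVV hR (.prod A B) t))
      (toVV hR B (.snd t)) :=
  (Eqv.snd (toVV_prod hR t)).trans (.snd_beta _ _)

theorem app_fromVV (f : Tm Γ none (.arr (vtr R (vtr R A)) (vtr R (vtr R B))))
    (u : Tm Γ none A) :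
    Eqv (.app (fromVV hR (.arr A B) f) u) (fromVV hR B (.app f (toVV hR A u))) := by
  refine (Eqv.app (fromVV_arr hR f) (.refl _)).trans ((Eqv.arr_beta _ _).trans (.of_eq ?_))
  simp only [Tm.inst, SSub.id_none, fromVV_sub, toVV_sub, Tm.sub, Tm.wk_sub_single]
  rfl

theorem app_toVV (f : Tm Γ none (.arr A B)) (u : Tm Γ none (vtr R (vtr R A))) :
    Eqv (.app (A := vtr R (vtr R A)) (B := vtr R (vtr R B)) (toVV hR (.arr A B) f) u)
      (toVV hR B (.app f (fromVV hR A u))) := by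
  refine (Eqv.app (toVV_arr hR f) (.refl _)).trans ((Eqv.arr_beta _ _).trans (.of_eq ?_))
  simp only [Tm.inst, SSub.id_none, fromVV_sub, toVV_sub, Tm.sub, Tm.wk_sub_single]
  rfl

theorem lapp_fromVV (f : Tm Γ none (.lolli (ctr R (ctr R C)) (ctr R (ctr R D))))
    (u : Tm Γ Δ (.comp C)) :
    Eqv (.lapp (fromVV hR (.lolli C D) f) u) (fromCC hR D (.lapp f (toCC hR C u))) := by
  refine (Eqv.lapp (fromVV_lolli hR f) (.refl _)).trans ((Eqv.lolli_beta _ _).trans (.of_eq ?_))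
  simp only [Tm.linst, fromCC_sub, toCC_sub, Tm.sub, Tm.sub_id_empty]

theorem lapp_toVV (f : Tm Γ none (.lolli C D)) (u : Tm Γ Δ (.comp (ctr R (ctr R C)))) :
    Eqv (.lapp (A := ctr R (ctr R C)) (B := ctr R (ctr R D)) (toVV hR (.lolli C D) f) u)
      (toCC hR D (.lapp f (fromCC hR C u))) := by
  refine (Eqv.lapp (toVV_lolli hR f) (.refl _)).trans ((Eqv.lolli_beta _ _).trans (.of_eq ?_))
  simp only [Tm.linst, fromCC_sub, toCC_sub, Tm.sub, Tm.sub_id_empty]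

theorem Tm.castC_sub (h : C = D) (t : Tm Γ Δ (.comp C)) (σ : VSub Γ Γ') (s : SSub Γ' Δ Δ') :
    (t.castC h).sub σ s = (t.sub σ s).castC h := by
  subst h
  rfl

theorem lapp_toVV_comp (t : Tm Γ none (.comp C)) (u : Tm Γ Δ (.comp (ctr R R))) :
    Eqv (.lapp (A := ctr R R) (B := ctr R (ctr R C)) (toVV hR (.comp C) t) u)
      (.ilet (u.castC hR.tr_self) (toCC hR C t)) := by
  refine (Eqv.lapp (toVV_comp hR t) (.refl _)).trans ((Eqv.lolli_beta _ _).trans (.of_eq ?_))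
  simp only [Tm.linst, Tm.sub, Tm.sub_id_empty, Tm.castC_sub]

theorem lapp_toVV_comp_top (t : Tm Γ none (.comp C)) :
    Eqv (.lapp (A := ctr R R) (B := ctr R (ctr R C)) (toVV hR (.comp C) t) (.topEq hR.tr_self))
      (toCC hR C t) :=
  (lapp_toVV_comp hR t _).trans (.ilet_topEq _ _)

theorem cfst_fromCC (t : Tm Γ Δ (.comp (.amp (ctr R (ctr R C)) (ctr R (ctr R D))))) :
    Eqv (.cfst (fromCC hR (.amp C D) t)) (fromCC hR C (.cfst t)) :=
  (Eqv.cfst (fromCC_amp hR t)).trans (.cfst_beta _ _)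

theorem csnd_fromCC (t : Tm Γ Δ (.comp (.amp (ctr R (ctr R C)) (ctr R (ctr R D))))) :
    Eqv (.csnd (fromCC hR (.amp C D) t)) (fromCC hR D (.csnd t)) :=
  (Eqv.csnd (fromCC_amp hR t)).trans (.csnd_beta _ _)

theorem cfst_toCC (t : Tm Γ Δ (.comp (.amp C D))) :
    Eqv (.cfst (A := ctr R (ctr R C)) (B := ctr R (ctr R D)) (toCC hR (.amp C D) t))
      (toCC hR C (.cfst t)) :=
  (Eqv.cfst (toCC_amp hR t)).trans (.cfst_beta _ _)

theorem csnd_toCC (t : Tm Γ Δ (.comp (.amp C D))) :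
    Eqv (.csnd (A := ctr R (ctr R C)) (B := ctr R (ctr R D)) (toCC hR (.amp C D) t))
      (toCC hR D (.csnd t)) :=
  (Eqv.csnd (toCC_amp hR t)).trans (.csnd_beta _ _)

theorem capp_fromCC (f : Tm Γ Δ (.comp (.pow (vtr R (vtr R A)) (ctr R (ctr R D)))))
    (u : Tm Γ none A) :
    Eqv (.capp (fromCC hR (.pow A D) f) u) (fromCC hR D (.capp f (toVV hR A u))) := by
  refine (Eqv.capp (fromCC_pow hR f) (.refl _)).trans ((Eqv.pow_beta _ _).trans (.of_eq ?_))
  simp only [Tm.inst, fromCC_sub, toVV_sub, Tm.sub, Tm.wk_sub_single_id]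
  rfl

theorem capp_toCC (f : Tm Γ Δ (.comp (.pow A D))) (u : Tm Γ none (vtr R (vtr R A))) :
    Eqv (.capp (A := vtr R (vtr R A)) (B := ctr R (ctr R D)) (toCC hR (.pow A D) f) u)
      (toCC hR D (.capp f (fromVV hR A u))) := by
  refine (Eqv.capp (toCC_pow hR f) (.refl _)).trans ((Eqv.pow_beta _ _).trans (.of_eq ?_))
  simp only [Tm.inst, fromVV_sub, toCC_sub, Tm.sub, Tm.wk_sub_single_id]
  rfl

theorem fromCC_bang_ten (t : Tm Γ none (vtr R (vtr R A))) (u : Tm Γ Δ (.comp (ctr R R))) :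
    Eqv (fromCC hR (.bang A) (.ten t u))
      (.ilet (u.castC hR.tr_self) (.bang (fromVV hR A t))) := by
  refine (fromCC_bang hR _).trans ((Eqv.copow_beta _ _ _).trans (.of_eq ?_))
  simp only [fromVV_sub, Tm.sub, Tm.castC_sub]
  rfl

theorem toCC_bang_bang (t : Tm Γ none A) :
    Eqv (toCC hR (.bang A) (.bang t))
      (.ten (A := vtr R (vtr R A)) (B := ctr R R) (toVV hR A t) (.topEq hR.tr_self)) := by
  refine (toCC_bang hR _).trans ((Eqv.bang_beta _ _).trans (.of_eq ?_))
  simp only [Tm.inst, SSub.id_none, toVV_sub, Tm.sub, Tm.topEq_sub]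
  rfl

theorem fromCC_ten (t : Tm Γ none (vtr R (vtr R A))) (u : Tm Γ Δ (.comp (ctr R (ctr R D)))) :
    Eqv (fromCC hR (.copow A D) (.ten t u)) (.ten (fromVV hR A t) (fromCC hR D u)) := by
  refine (fromCC_copow hR _).trans ((Eqv.copow_beta _ _ _).trans (.of_eq ?_))
  simp only [fromVV_sub, fromCC_sub, Tm.sub]
  rfl

theorem toCC_ten (t : Tm Γ none A) (u : Tm Γ Δ (.comp D)) :
    Eqv (toCC hR (.copow A D) (.ten t u))
      (.ten (A := vtr R (vtr R A)) (B := ctr R (ctr R D)) (toVV hR A t) (toCC hR D u)) := by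
  refine (toCC_copow hR _).trans ((Eqv.copow_beta _ _ _).trans (.of_eq ?_))
  simp only [toVV_sub, toCC_sub, Tm.sub]
  rfl

theorem fromCC_inl (t : Tm Γ Δ (.comp (ctr R (ctr R C)))) :
    Eqv (fromCC hR (.plus C D) (.inl (B := ctr R (ctr R D)) t)) (.inl (fromCC hR C t)) := by
  refine (fromCC_plus hR _).trans ((Eqv.inl_beta _ _ _).trans (.of_eq ?_))
  simp only [Tm.linst, fromCC_sub, Tm.sub]

theorem fromCC_inr (t : Tm Γ Δ (.comp (ctr R (ctr R D)))) :
    Eqv (fromCC hR (.plus C D) (.inr (A := ctr R (ctr R C)) t)) (.inr (fromCC hR D t)) := by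
  refine (fromCC_plus hR _).trans ((Eqv.inr_beta _ _ _).trans (.of_eq ?_))
  simp only [Tm.linst, fromCC_sub, Tm.sub]

theorem toCC_inl (t : Tm Γ Δ (.comp C)) :
    Eqv (toCC hR (.plus C D) (.inl t))
      (.inl (A := ctr R (ctr R C)) (B := ctr R (ctr R D)) (toCC hR C t)) := by
  refine (toCC_plus hR _).trans ((Eqv.inl_beta _ _ _).trans (.of_eq ?_))
  simp only [Tm.linst, toCC_sub, Tm.sub]

theorem toCC_inr (t : Tm Γ Δ (.comp D)) :
    Eqv (toCC hR (.plus C D) (.inr t))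
      (.inr (A := ctr R (ctr R C)) (B := ctr R (ctr R D)) (toCC hR D t)) := by
  refine (toCC_plus hR _).trans ((Eqv.inr_beta _ _ _).trans (.of_eq ?_))
  simp only [Tm.linst, toCC_sub, Tm.sub]

end Elimination

theorem Eqv.lolli_ext {C D : CTy V W} {f g : Tm Γ none (.lolli C D)}
    (h : Eqv (.lapp f .svar) (.lapp g .svar)) : Eqv f g :=
  (Eqv.lolli_eta f).symm.trans ((Eqv.llam h).trans (.lolli_eta g))

theorem Eqv.lolli_castC_ext {C D : CTy V W} (hC : C = .I) {f g : Tm Γ none (.lolli C D)}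
    (h : Eqv (.lapp f (.topEq hC)) (.lapp g (.topEq hC))) : Eqv f g := by
  subst hC
  refine .lolli_ext (.I_ext ?_)
  rw [← Tm.lapp_eq_linst, ← Tm.lapp_eq_linst]
  exact h

theorem Eqv.ten_castC_eta {A : VTy V W} {C : CTy V W} (hC : C = .I) (t : Tm Γ none A) :
    Eqv (.ilet (Tm.svar.castC hC) (.ten t (.topEq hC))) (.ten t (.svar : Tm Γ (some C) _)) := by
  have h := Eqv.ilet_castC_eta hC (.svar : Tm Γ (some C) _) (.ten t .svar)
  simp only [Tm.linst, Tm.sub, Tm.sub_id_empty] at h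
  exact h

/-- A linear equation may be checked at the variable of the stoup. -/
theorem fromCC_toCC_of_svar {C : CTy V W} {Γ : Ctx V W}
    (h : Eqv (fromCC hR C (toCC hR C (.svar : Tm Γ _ _))) .svar)
    {Δ : Stoup V W} (t : Tm Γ Δ (.comp C)) : Eqv (fromCC hR C (toCC hR C t)) t := by
  have := h.linst (.refl t)
  rwa [fromCC_linst, toCC_linst] at this

theorem toCC_fromCC_of_svar {C : CTy V W} {Γ : Ctx V W}
    (h : Eqv (toCC hR C (fromCC hR C (.svar : Tm Γ _ _))) .svar)
    {Δ : Stoup V W} (t : Tm Γ Δ (.comp (ctr R (ctr R C)))) :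
    Eqv (toCC hR C (fromCC hR C t)) t := by
  have := h.linst (.refl t)
  rwa [toCC_linst, fromCC_linst] at this

theorem toCC_fromCC_svar_linst (C : CTy V W) (u : Tm Γ Δ (.comp (ctr R (ctr R C)))) :
    (toCC hR C (fromCC hR C .svar)).linst u = toCC hR C (fromCC hR C u) := by
  rw [toCC_linst, fromCC_linst]
  rfl

theorem toCC_fromCC_svar_wk_linst (C : CTy V W) (A : VTy V W)
    (u : Tm (A :: Γ) Δ (.comp (ctr R (ctr R C)))) :
    ((toCC hR C (fromCC hR C .svar)).wk A).linst u = toCC hR C (fromCC hR C u) := by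
  rw [toCC_wk, fromCC_wk]
  exact toCC_fromCC_svar_linst hR C u

mutual

theorem fromVV_toVV_and (A : VTy V W) :
    (∀ (Γ : Ctx V W) (t : Tm Γ none A), Eqv (fromVV hR A (toVV hR A t)) t) ∧
    (∀ (Γ : Ctx V W) (t : Tm Γ none (vtr R (vtr R A))), Eqv (toVV hR A (fromVV hR A t)) t) :=
  match A with
  | .const a =>
    ⟨fun _ _ => (fromVV_const hR a _).trans (toVV_const hR a _),
      fun _ _ => (toVV_const hR a _).trans (fromVV_const hR a _)⟩
  | .one =>
    ⟨fun _ t => (Eqv.one_eta _).trans (Eqv.one_eta t).symm,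
      fun _ t => Eqv.trans (Eqv.one_eta (V := V) (W := W) _) (Eqv.one_eta t).symm⟩
  | .prod A B => by
    obtain ⟨hA, hA'⟩ := fromVV_toVV_and A
    obtain ⟨hB, hB'⟩ := fromVV_toVV_and B
    refine ⟨fun Γ t => ?_, fun Γ t => ?_⟩
    · exact (fromVV_prod hR _).trans ((Eqv.pair
        ((Eqv.fromVV hR A (fst_toVV hR t)).trans (hA _ _))
        ((Eqv.fromVV hR B (snd_toVV hR t)).trans (hB _ _))).trans (.prod_eta t))
    · exact (toVV_prod hR _).trans ((Eqv.pair
        ((Eqv.toVV hR A (fst_fromVV hR t)).trans (hA' _ _))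
        ((Eqv.toVV hR B (snd_fromVV hR t)).trans (hB' _ _))).trans (.prod_eta t))
  | .arr A B => by
    obtain ⟨hA, hA'⟩ := fromVV_toVV_and A
    obtain ⟨hB, hB'⟩ := fromVV_toVV_and B
    refine ⟨fun Γ t => ?_, fun Γ t => ?_⟩
    · refine (fromVV_arr hR _).trans ((Eqv.lam ?_).trans (.arr_eta t))
      exact (Eqv.fromVV hR B ((Eqv.app (.of_eq (toVV_wk hR (.arr A B) A t)) (.refl _)).trans
        (app_toVV hR _ _))).trans
        ((hB _ _).trans (.app (.refl _) (hA _ _)))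
    · refine (toVV_arr hR _).trans ((Eqv.lam ?_).trans (.arr_eta t))
      exact (Eqv.toVV hR B ((Eqv.app (.of_eq (fromVV_wk hR (.arr A B) _ t)) (.refl _)).trans
        (app_fromVV hR _ _))).trans
        ((hB' _ _).trans (.app (.refl _) (hA' _ _)))
  | .comp C => by
    obtain ⟨hC, hC'⟩ := fromCC_toCC_and C
    refine ⟨fun Γ t => ?_, fun Γ t => ?_⟩
    · exact (fromVV_comp hR _).trans
        ((Eqv.fromCC hR C (lapp_toVV_comp_top hR t)).trans (hC _ _ _))
    · exact .lolli_castC_ext hR.tr_self ((lapp_toVV_comp_top hR _).trans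
        ((Eqv.toCC hR C (fromVV_comp hR t)).trans (hC' _ _ _)))
  | .lolli C D => by
    obtain ⟨hC, hC'⟩ := fromCC_toCC_and C
    obtain ⟨hD, hD'⟩ := fromCC_toCC_and D
    refine ⟨fun Γ t => ?_, fun Γ t => ?_⟩
    · exact .lolli_ext ((lapp_fromVV hR _ _).trans ((Eqv.fromCC hR D (lapp_toVV hR _ _)).trans
        ((hD _ _ _).trans (.lapp (.refl _) (hC _ _ _)))))
    · exact .lolli_ext ((lapp_toVV hR _ _).trans ((Eqv.toCC hR D (lapp_fromVV hR _ _)).trans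
        ((hD' _ _ _).trans (.lapp (.refl _) (hC' _ _ _)))))

theorem fromCC_toCC_and (C : CTy V W) :
    (∀ (Γ : Ctx V W) (Δ : Stoup V W) (t : Tm Γ Δ (.comp C)),
      Eqv (fromCC hR C (toCC hR C t)) t) ∧
    (∀ (Γ : Ctx V W) (Δ : Stoup V W) (t : Tm Γ Δ (.comp (ctr R (ctr R C)))),
      Eqv (toCC hR C (fromCC hR C t)) t) :=
  match C with
  | .const a =>
    ⟨fun _ _ t => (fromCC_const hR a _).trans
        ((Eqv.castC _ (toCC_const hR a t)).trans (.of_eq (t.castC_castC _ _))),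
      fun _ _ t => (toCC_const hR a _).trans
        ((Eqv.castC _ (fromCC_const hR a t)).trans (.of_eq (t.castC_castC _ _)))⟩
  | .one =>
    ⟨fun _ _ t => (Eqv.cone_eta _).trans (Eqv.cone_eta t).symm,
      fun _ _ t => Eqv.trans (Eqv.cone_eta (V := V) (W := W) _) (Eqv.cone_eta t).symm⟩
  | .amp C D => by
    obtain ⟨hC, hC'⟩ := fromCC_toCC_and C
    obtain ⟨hD, hD'⟩ := fromCC_toCC_and D
    refine ⟨fun Γ Δ t => ?_, fun Γ Δ t => ?_⟩
    · exact (fromCC_amp hR _).trans ((Eqv.cpair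
        ((Eqv.fromCC hR C (cfst_toCC hR t)).trans (hC _ _ _))
        ((Eqv.fromCC hR D (csnd_toCC hR t)).trans (hD _ _ _))).trans (.amp_eta t))
    · exact (toCC_amp hR _).trans ((Eqv.cpair
        ((Eqv.toCC hR C (cfst_fromCC hR t)).trans (hC' _ _ _))
        ((Eqv.toCC hR D (csnd_fromCC hR t)).trans (hD' _ _ _))).trans (.amp_eta t))
  | .pow A D => by
    obtain ⟨hA, hA'⟩ := fromVV_toVV_and A
    obtain ⟨hD, hD'⟩ := fromCC_toCC_and D
    refine ⟨fun Γ Δ t => ?_, fun Γ Δ t => ?_⟩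
    · refine (fromCC_pow hR _).trans ((Eqv.clam ?_).trans (.pow_eta t))
      exact (Eqv.fromCC hR D ((Eqv.capp (.of_eq (toCC_wk hR (.pow A D) A t)) (.refl _)).trans
        (capp_toCC hR _ _))).trans
        ((hD _ _ _).trans (.capp (.refl _) (hA _ _)))
    · refine (toCC_pow hR _).trans ((Eqv.clam ?_).trans (.pow_eta t))
      exact (Eqv.toCC hR D ((Eqv.capp (.of_eq (fromCC_wk hR (.pow A D) _ t)) (.refl _)).trans
        (capp_fromCC hR _ _))).trans
        ((hD' _ _ _).trans (.capp (.refl _) (hA' _ _)))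
  | .I =>
    ⟨fun _ _ t => (fromCC_I hR _).trans
        ((Eqv.castC _ (toCC_I hR t)).trans (.of_eq (t.castC_castC _ _))),
      fun _ _ t => (toCC_I hR _).trans
        ((Eqv.castC _ (fromCC_I hR t)).trans (.of_eq (t.castC_castC _ _)))⟩
  | .bang A => by
    obtain ⟨hA, hA'⟩ := fromVV_toVV_and A
    refine ⟨fun Γ Δ t => fromCC_toCC_of_svar hR (.bang_ext ?_) t,
      fun Γ Δ t => toCC_fromCC_of_svar hR (.copow_ext ?_) t⟩
    · rw [fromCC_wk, toCC_wk, fromCC_linst, toCC_linst]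
      exact (Eqv.fromCC hR _ (toCC_bang_bang hR _)).trans ((fromCC_bang_ten hR _ _).trans
        ((Eqv.ilet_topEq _ _).trans (.bang (hA _ _))))
    · refine (Eqv.of_eq (toCC_fromCC_svar_wk_linst hR (.bang A) _ _)).trans ?_
      refine (Eqv.toCC hR _ (fromCC_bang_ten hR _ _)).trans ?_
      rw [toCC, Tm.lapp_eq_linst]
      refine (Eqv.linst_ilet _ _ _).trans ?_
      rw [← Tm.lapp_eq_linst]
      exact (Eqv.ilet (.refl _) ((toCC_bang_bang hR _).trans
        (.ten (hA' _ _) (.refl _)))).trans (.ten_castC_eta _ _)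
  | .copow A D => by
    obtain ⟨hA, hA'⟩ := fromVV_toVV_and A
    obtain ⟨hD, hD'⟩ := fromCC_toCC_and D
    refine ⟨fun Γ Δ t => fromCC_toCC_of_svar hR (.copow_ext ?_) t,
      fun Γ Δ t => toCC_fromCC_of_svar hR (.copow_ext ?_) t⟩
    · rw [fromCC_wk, toCC_wk, fromCC_linst, toCC_linst]
      exact (Eqv.fromCC hR _ (toCC_ten hR _ _)).trans ((fromCC_ten hR _ _).trans
        (.ten (hA _ _) (hD _ _ _)))
    · refine (Eqv.of_eq (toCC_fromCC_svar_wk_linst hR (.copow A D) _ _)).trans ?_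
      exact (Eqv.toCC hR _ (fromCC_ten hR _ _)).trans ((toCC_ten hR _ _).trans
        (.ten (hA' _ _) (hD' _ _ _)))
  | .zero =>
    ⟨fun _ _ _ => (fromCC_zero hR _).trans (toCC_zero hR _),
      fun _ _ _ => (toCC_zero hR _).trans (fromCC_zero hR _)⟩
  | .plus C D => by
    obtain ⟨hC, hC'⟩ := fromCC_toCC_and C
    obtain ⟨hD, hD'⟩ := fromCC_toCC_and D
    refine ⟨fun Γ Δ t => fromCC_toCC_of_svar hR (.plus_ext ?_ ?_) t,
      fun Γ Δ t => toCC_fromCC_of_svar hR (.plus_ext ?_ ?_) t⟩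
    · rw [fromCC_linst, toCC_linst]
      exact (Eqv.fromCC hR _ (toCC_inl hR _)).trans ((fromCC_inl hR _).trans
        (.inl (hC _ _ _)))
    · rw [fromCC_linst, toCC_linst]
      exact (Eqv.fromCC hR _ (toCC_inr hR _)).trans ((fromCC_inr hR _).trans
        (.inr (hD _ _ _)))
    · refine (Eqv.of_eq (toCC_fromCC_svar_linst hR (.plus C D) _)).trans ?_
      exact (Eqv.toCC hR _ (fromCC_inl hR _)).trans ((toCC_inl hR _).trans
        (.inl (hC' _ _ _)))
    · refine (Eqv.of_eq (toCC_fromCC_svar_linst hR (.plus C D) _)).trans ?_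
      exact (Eqv.toCC hR _ (fromCC_inr hR _)).trans ((toCC_inr hR _).trans
        (.inr (hD' _ _ _)))

end

theorem fromVV_toVV (A : VTy V W) (t : Tm Γ none A) : Eqv (fromVV hR A (toVV hR A t)) t :=
  (fromVV_toVV_and hR A).1 Γ t

theorem toVV_fromVV (A : VTy V W) (t : Tm Γ none (vtr R (vtr R A))) :
    Eqv (toVV hR A (fromVV hR A t)) t :=
  (fromVV_toVV_and hR A).2 Γ t

theorem fromCC_toCC (C : CTy V W) (t : Tm Γ Δ (.comp C)) :
    Eqv (fromCC hR C (toCC hR C t)) t :=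
  (fromCC_toCC_and hR C).1 Γ Δ t

theorem toCC_fromCC (C : CTy V W) (t : Tm Γ Δ (.comp (ctr R (ctr R C)))) :
    Eqv (toCC hR C (fromCC hR C t)) t :=
  (fromCC_toCC_and hR C).2 Γ Δ t

theorem isVIso_viso (A : VTy V W) : IsVIso (viso hR A) (visoInv hR A) :=
  ⟨.lam (fromVV_toVV hR A _), .lam (toVV_fromVV hR A _)⟩

theorem isCIso_ciso (C : CTy V W) : IsCIso (ciso hR C) (cisoInv hR C) := by
  have h := fromCC_toCC hR C (.svar : Tm [] _ _)
  have h' := toCC_fromCC hR C (.svar : Tm [] _ _)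
  simp only [fromCC, toCC, Tm.closed_nil] at h h'
  exact ⟨.llam h, .llam h'⟩

end Iso

section Linst

variable {Γ Γ' : Ctx V W} {Δ : Stoup V W} {A : VTy V W} {B C D E : CTy V W}

theorem Tm.linst_ren (t : Tm Γ (some D) A) (u : Tm Γ Δ (.comp D)) (ρ : Ren Γ Γ') :
    (t.linst u).ren ρ = (t.ren ρ).linst (u.ren ρ) := by
  rw [Tm.linst, Tm.linst, Tm.ren_sub, Tm.sub_ren]
  rfl

theorem Tm.clam_linst (t : Tm (A :: Γ) (some D) (.comp B)) (u : Tm Γ Δ (.comp D)) :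
    (Tm.clam t).linst u = .clam (t.linst (u.wk A)) := by
  simp only [Tm.linst, Tm.sub, VSub.id_lift]
  rfl

theorem Tm.capp_linst (s : Tm Γ (some D) (.comp (.pow A B))) (t : Tm Γ none A)
    (u : Tm Γ Δ (.comp D)) : (Tm.capp s t).linst u = .capp (s.linst u) t := by
  simp only [Tm.linst, Tm.sub, Tm.sub_id_empty]

theorem Tm.ilet_linst (s : Tm Γ (some D) (.comp .I)) (t : Tm Γ none (.comp B))
    (u : Tm Γ Δ (.comp D)) : (Tm.ilet s t).linst u = .ilet (s.linst u) t := by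
  simp only [Tm.linst, Tm.sub, Tm.sub_id_empty]

theorem Tm.blet_linst (s : Tm Γ (some D) (.comp (.bang A))) (t : Tm (A :: Γ) none (.comp B))
    (u : Tm Γ Δ (.comp D)) : (Tm.blet s t).linst u = .blet (s.linst u) t := by
  simp only [Tm.linst, Tm.sub, VSub.id_lift, Tm.sub_id_empty]

theorem Tm.ten_linst (s : Tm Γ none A) (t : Tm Γ (some D) (.comp B))
    (u : Tm Γ Δ (.comp D)) : (Tm.ten s t).linst u = .ten s (t.linst u) := by
  simp only [Tm.linst, Tm.sub, Tm.sub_id_empty]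

theorem Tm.tlet_linst (s : Tm Γ (some D) (.comp (.copow A B)))
    (t : Tm (A :: Γ) (some B) (.comp C)) (u : Tm Γ Δ (.comp D)) :
    (Tm.tlet s t).linst u = .tlet (s.linst u) t := by
  simp only [Tm.linst, Tm.sub, VSub.id_lift, Tm.sub_id_svar]

theorem Tm.cases_linst (s : Tm Γ (some D) (.comp (.plus B C))) (t : Tm Γ (some B) (.comp E))
    (t' : Tm Γ (some C) (.comp E)) (u : Tm Γ Δ (.comp D)) :
    (Tm.cases s t t').linst u = .cases (s.linst u) t t' := by
  simp only [Tm.linst, Tm.sub, Tm.sub_id_svar]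

theorem Tm.lapp_linst (s : Tm Γ none (.lolli B C)) (t : Tm Γ (some D) (.comp B))
    (u : Tm Γ Δ (.comp D)) : (Tm.lapp s t).linst u = .lapp s (t.linst u) := by
  simp only [Tm.linst, Tm.sub, Tm.sub_id_empty]

end Linst

/-! ## Translation and substitution -/

section Translation

variable (R : CTy V W)

/-- The renaming `ρ'` of translated contexts is the translation of `ρ`. -/
def Ren.IsTr {Γ Γ' : Ctx V W} (ρ : Ren Γ Γ') (ρ' : Ren (Ctx.tr R Γ) (Ctx.tr R Γ')) : Prop :=
  ∀ A (x : Var Γ A), ρ' _ (x.tr R) = (ρ A x).tr R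

theorem Ren.IsTr.lift {R : CTy V W} {Γ Γ' : Ctx V W} {ρ : Ren Γ Γ'}
    {ρ' : Ren (Ctx.tr R Γ) (Ctx.tr R Γ')} (h : ρ.IsTr R ρ') (B : VTy V W) :
    (ρ.lift B).IsTr R (ρ'.lift (vtr R B))
  | _, .zero => rfl
  | _, .succ x => congrArg Var.succ (h _ x)

mutual

theorem Tm.trV_ren {Γ Γ' : Ctx V W} {A : VTy V W} {ρ : Ren Γ Γ'}
    {ρ' : Ren (Ctx.tr R Γ) (Ctx.tr R Γ')} (h : ρ.IsTr R ρ') :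
    (t : Tm Γ none A) → (t.ren ρ).trV R = (t.trV R).ren ρ'
  | .var x => (congrArg Tm.var (h _ x)).symm
  | .star => rfl
  | .pair t u => congrArg₂ Tm.pair (t.trV_ren h) (u.trV_ren h)
  | .fst (A := A) (B := B) t =>
    congrArg (Tm.fst (A := vtr R A) (B := vtr R B)) (t.trV_ren h)
  | .snd (A := A) (B := B) t =>
    congrArg (Tm.snd (A := vtr R A) (B := vtr R B)) (t.trV_ren h)
  | .lam t => congrArg Tm.lam (t.trV_ren (h.lift _))
  | .app (A := A) (B := B) t u =>
    congrArg₂ (Tm.app (A := vtr R A) (B := vtr R B)) (t.trV_ren h) (u.trV_ren h)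
  | .cstar => rfl
  | .cpair (A := A) (B := B) t u =>
    congrArg₂ (fun (x : Tm _ none (.lolli (ctr R A) R)) (y : Tm _ none (.lolli (ctr R B) R)) =>
      Tm.llam (.cases .svar (.lapp x .svar) (.lapp y .svar))) (t.trV_ren h) (u.trV_ren h)
  | .cfst (A := A) (B := B) t =>
    congrArg (fun x : Tm _ none (.lolli (.plus (ctr R A) (ctr R B)) R) =>
      Tm.llam (.lapp x (.inl .svar))) (t.trV_ren h)
  | .csnd (A := A) (B := B) t =>
    congrArg (fun x : Tm _ none (.lolli (.plus (ctr R A) (ctr R B)) R) =>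
      Tm.llam (.lapp x (.inr .svar))) (t.trV_ren h)
  | .clam (A := A) (B := B) t =>
    congrArg (fun x : Tm (vtr R A :: _) none (.lolli (ctr R B) R) =>
      Tm.llam (.tlet .svar (.lapp x .svar))) (t.trV_ren (h.lift _))
  | .capp (A := A) (B := B) s t =>
    congrArg₂ (fun (x : Tm _ none (.lolli (.copow (vtr R A) (ctr R B)) R)) y =>
      Tm.llam (.lapp x (.ten y .svar))) (s.trV_ren h) (t.trV_ren h)
  | .top => rfl
  | .ilet (A := A) t u =>
    congrArg₂ (fun (x : Tm _ none (.lolli R R)) (y : Tm _ none (.lolli (ctr R A) R)) =>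
      Tm.llam (.lapp x (.lapp y .svar))) (t.trV_ren h) (u.trV_ren h)
  | .bang t =>
    congrArg (fun x => Tm.llam (.capp (B := R) .svar x)) (t.trV_ren h)
  | .blet (A := A) (B := B) t u =>
    congrArg₂ (fun (x : Tm _ none (.lolli (.pow (vtr R A) R) R))
      (y : Tm (vtr R A :: _) none (.lolli (ctr R B) R)) =>
      Tm.llam (.lapp x (.clam (.lapp y .svar)))) (t.trV_ren h) (u.trV_ren (h.lift _))
  | .ten (B := B) t u =>
    congrArg₂ (fun x (y : Tm _ none (.lolli (ctr R B) R)) =>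
      Tm.llam (.lapp y (.capp .svar x))) (t.trV_ren h) (u.trV_ren h)
  | .tlet (A := A) (B := B) (C := C) s t =>
    congrArg₂ (fun (x : Tm _ none (.lolli (.pow (vtr R A) (ctr R B)) R))
      (y : Tm (vtr R A :: _) (some (ctr R C)) (.comp (ctr R B))) =>
      Tm.llam (.lapp x (.clam y))) (s.trV_ren h) (t.trC_ren (h.lift _))
  | .image (A := A) t =>
    congrArg (fun x : Tm _ none (.lolli .one R) =>
      Tm.llam (A := ctr R A) (.lapp x .cstar)) (t.trV_ren h)
  | .inl (A := A) (B := B) t =>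
    congrArg (fun x : Tm _ none (.lolli (ctr R A) R) =>
      Tm.llam (.lapp x (.cfst (B := ctr R B) .svar))) (t.trV_ren h)
  | .inr (A := A) (B := B) t =>
    congrArg (fun x : Tm _ none (.lolli (ctr R B) R) =>
      Tm.llam (.lapp x (.csnd (A := ctr R A) .svar))) (t.trV_ren h)
  | .cases (A := A) (B := B) s t u =>
    congrArg₂ (fun (x : Tm _ none (.lolli (.amp (ctr R A) (ctr R B)) R)) y =>
      Tm.llam (.lapp x y)) (s.trV_ren h) (congrArg₂ Tm.cpair (t.trC_ren h) (u.trC_ren h))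
  | .llam t => congrArg Tm.llam (t.trC_ren h)
  | .lapp (A := A) (B := B) s t =>
    congrArg₂ (fun (x : Tm _ none (.lolli (ctr R B) (ctr R A)))
      (y : Tm _ none (.lolli (ctr R A) R)) =>
      Tm.llam (.lapp y (.lapp x .svar))) (s.trV_ren h) (t.trV_ren h)
termination_by t => sizeOf t

theorem Tm.trC_ren {Γ Γ' : Ctx V W} {A B : CTy V W} {ρ : Ren Γ Γ'}
    {ρ' : Ren (Ctx.tr R Γ) (Ctx.tr R Γ')} (h : ρ.IsTr R ρ') :
    (t : Tm Γ (some A) (.comp B)) → (t.ren ρ).trC R = (t.trC R).ren ρ'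
  | .svar => rfl
  | .cstar => rfl
  | .cpair t u => congrArg₂ (Tm.cases .svar) (t.trC_ren h) (u.trC_ren h)
  | .cfst (A := A) (B := B) t =>
    (congrArg (Tm.linst (D := .plus (ctr R A) (ctr R B)) · (.inl .svar)) (t.trC_ren h)).trans
      (Tm.linst_ren (D := .plus (ctr R A) (ctr R B)) (t.trC R) (.inl .svar) ρ').symm
  | .csnd (A := A) (B := B) t =>
    (congrArg (Tm.linst (D := .plus (ctr R A) (ctr R B)) · (.inr .svar)) (t.trC_ren h)).trans
      (Tm.linst_ren (D := .plus (ctr R A) (ctr R B)) (t.trC R) (.inr .svar) ρ').symm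
  | .clam t => congrArg (Tm.tlet .svar) (t.trC_ren (h.lift _))
  | .capp (A := A) (B := B) s t =>
    (congrArg₂ (fun x y => Tm.linst (D := .copow (vtr R A) (ctr R B)) x (.ten y .svar))
      (s.trC_ren h) (t.trV_ren h)).trans
        (Tm.linst_ren (D := .copow (vtr R A) (ctr R B)) (s.trC R) (.ten (t.trV R) .svar) ρ').symm
  | .ilet (A := A) t u =>
    (congrArg₂ (fun x (y : Tm _ none (.lolli (ctr R A) R)) =>
      Tm.linst (D := R) x (.lapp y .svar)) (t.trC_ren h) (u.trV_ren h)).trans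
      (Tm.linst_ren (D := R) (t.trC R) (.lapp (A := ctr R A) (u.trV R) .svar) ρ').symm
  | .blet (A := A) (B := B) t u =>
    (congrArg₂ (fun x (y : Tm (vtr R A :: _) none (.lolli (ctr R B) R)) =>
      Tm.linst (D := .pow (vtr R A) R) x (.clam (.lapp y .svar)))
      (t.trC_ren h) (u.trV_ren (h.lift _))).trans (Tm.linst_ren (D := .pow (vtr R A) R) (t.trC R)
        (.clam (.lapp (A := ctr R B) (u.trV R) .svar)) ρ').symm
  | .ten t u =>
    (congrArg₂ (fun x y => Tm.linst y (.capp .svar x)) (t.trV_ren h) (u.trC_ren h)).trans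
      (Tm.linst_ren (u.trC R) (.capp .svar (t.trV R)) ρ').symm
  | .tlet (A := A) (B := B) s t =>
    (congrArg₂ (fun x y => Tm.linst (D := .pow (vtr R A) (ctr R B)) x (.clam y))
      (s.trC_ren h) (t.trC_ren (h.lift _))).trans
        (Tm.linst_ren (D := .pow (vtr R A) (ctr R B)) (s.trC R) (.clam (t.trC R)) ρ').symm
  | .image (A := A) t =>
    (congrArg (fun x => Tm.linst (Δ := some (ctr R A)) (D := .one) x .cstar) (t.trC_ren h)).trans
      (Tm.linst_ren (D := .one) (t.trC R) .cstar ρ').symm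
  | .inl (A := A) (B := B) t =>
    (congrArg (fun x => Tm.linst (D := ctr R A) x (.cfst (B := ctr R B) .svar))
      (t.trC_ren h)).trans
        (Tm.linst_ren (D := ctr R A) (t.trC R) (.cfst (B := ctr R B) .svar) ρ').symm
  | .inr (A := A) (B := B) t =>
    (congrArg (fun x => Tm.linst (D := ctr R B) x (.csnd (A := ctr R A) .svar))
      (t.trC_ren h)).trans
        (Tm.linst_ren (D := ctr R B) (t.trC R) (.csnd (A := ctr R A) .svar) ρ').symm
  | .cases (A := A) (B := B) s t u =>
    (congrArg₂ (Tm.linst (D := .amp (ctr R A) (ctr R B))) (s.trC_ren h)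
      (congrArg₂ Tm.cpair (t.trC_ren h) (u.trC_ren h))).trans
      (Tm.linst_ren (D := .amp (ctr R A) (ctr R B)) (s.trC R) (.cpair (t.trC R) (u.trC R)) ρ').symm
  | .lapp (A := A) (B := B) s t =>
    (congrArg₂ (fun (x : Tm _ none (.lolli (ctr R B) (ctr R A))) y =>
      Tm.linst (D := ctr R A) y (.lapp x .svar)) (s.trV_ren h) (t.trC_ren h)).trans
      (Tm.linst_ren (D := ctr R A) (t.trC R) (.lapp (A := ctr R B) (s.trV R) .svar) ρ').symm
termination_by t => sizeOf t

end

theorem Tm.trC_wk {Γ : Ctx V W} {A B : CTy V W} (t : Tm Γ (some A) (.comp B)) (C : VTy V W) :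
    (t.wk C).trC R = (t.trC R).wk (vtr R C) :=
  t.trC_ren R fun _ _ => rfl

end Translation

section Translation

variable (R : CTy V W)

/-- The translation reverses substitution for the variable of the stoup. -/
theorem Tm.trC_linst {Γ : Ctx V W} {B C D : CTy V W} :
    (t : Tm Γ (some D) (.comp B)) → (u : Tm Γ (some C) (.comp D)) →
      Eqv ((t.linst u).trC R) ((u.trC R).linst (t.trC R))
  | .svar, u => .of_eq (Tm.linst_svar (u.trC R)).symm
  | .cstar, u => (Eqv.linst_image _ _).symm
  | .cpair t t', u =>
    (Eqv.cases (.refl _) (t.trC_linst u) (t'.trC_linst u)).trans (Eqv.linst_cases _ _ _ _).symm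
  | .cfst (A := A) (B := B) t, u =>
    (Eqv.linst (D := .plus (ctr R A) (ctr R B)) (t.trC_linst u) (.refl (.inl .svar))).trans
      (.of_eq (Tm.linst_linst _ _ _))
  | .csnd (A := A) (B := B) t, u =>
    (Eqv.linst (D := .plus (ctr R A) (ctr R B)) (t.trC_linst u) (.refl (.inr .svar))).trans
      (.of_eq (Tm.linst_linst _ _ _))
  | .clam (A := A) t, u => by
    rw [Tm.clam_linst]
    have h := t.trC_linst (u.wk A)
    rw [Tm.trC_wk] at h
    exact (Eqv.tlet (.refl _) h).trans (Eqv.linst_tlet _ _ _).symm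
  | .capp (A := A) (B := B) s t, u => by
    rw [Tm.capp_linst]
    exact (Eqv.linst (D := .copow (vtr R A) (ctr R B)) (s.trC_linst u)
      (.refl (.ten (t.trV R) .svar))).trans (.of_eq (Tm.linst_linst _ _ _))
  | .ilet (A := A) s t, u => by
    rw [Tm.ilet_linst]
    exact (Eqv.linst (D := R) (s.trC_linst u)
      (.refl (.lapp (A := ctr R A) (t.trV R) .svar))).trans (.of_eq (Tm.linst_linst _ _ _))
  | .blet (A := A) (B := B) s t, u => by
    rw [Tm.blet_linst]
    exact (Eqv.linst (D := .pow (vtr R A) R) (s.trC_linst u)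
      (.refl (.clam (.lapp (A := ctr R B) (t.trV R) .svar)))).trans
      (.of_eq (Tm.linst_linst _ _ _))
  | .ten s t, u => by
    rw [Tm.ten_linst]
    exact (Eqv.linst (t.trC_linst u) (.refl (.capp .svar (s.trV R)))).trans
      (.of_eq (Tm.linst_linst _ _ _))
  | .tlet (A := A) (B := B) s t, u => by
    rw [Tm.tlet_linst]
    exact (Eqv.linst (D := .pow (vtr R A) (ctr R B)) (s.trC_linst u)
      (.refl (.clam (t.trC R)))).trans (.of_eq (Tm.linst_linst _ _ _))
  | .image t, u =>
    (Eqv.linst (D := .one) (t.trC_linst u) (.refl .cstar)).trans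
      (.of_eq (Tm.linst_linst _ _ _))
  | .inl t, u =>
    (Eqv.linst (t.trC_linst u) (.refl (.cfst .svar))).trans (.of_eq (Tm.linst_linst _ _ _))
  | .inr t, u =>
    (Eqv.linst (t.trC_linst u) (.refl (.csnd .svar))).trans (.of_eq (Tm.linst_linst _ _ _))
  | .cases (A := A) (B := B) s t t', u => by
    rw [Tm.cases_linst]
    exact (Eqv.linst (D := .amp (ctr R A) (ctr R B)) (s.trC_linst u)
      (.refl (.cpair (t.trC R) (t'.trC R)))).trans (.of_eq (Tm.linst_linst _ _ _))
  | .lapp (A := A) (B := B) s t, u => by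
    rw [Tm.lapp_linst]
    exact (Eqv.linst (D := ctr R A) (t.trC_linst u)
      (.refl (.lapp (A := ctr R B) (s.trV R) .svar))).trans (.of_eq (Tm.linst_linst _ _ _))
termination_by t => sizeOf t

end Translation

/-! ## The double translation -/

section DoubleTranslation

variable {R : CTy V W} (hR : R.IsConstOrI) {Γ : Ctx V W} {Δ : Stoup V W}

/-- The double translation of a term of a computation type, as a term of the doubly translated
computation type: `t°°[⊤]` if the stoup is empty, and `t••` otherwise. -/
noncomputable def Tm.trTr {B : CTy V W} : {Δ : Stoup V W} → Tm Γ Δ (.comp B) →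
    Tm (Ctx.tr R (Ctx.tr R Γ)) (Δ.map fun C => ctr R (ctr R C)) (.comp (ctr R (ctr R B)))
  | none, t => .lapp (A := ctr R R) ((t.trV R).trV R) (.topEq hR.tr_self)
  | some _, t => (t.trC R).trC R

theorem trTr_of_lapp {A B : CTy V W} (f : Tm Γ none (.lolli (ctr R A) R))
    (v : Tm Γ (some (ctr R B)) (.comp (ctr R A))) :
    Eqv (.lapp (A := ctr R R) ((Tm.llam (Tm.lapp f v)).trV R) (.topEq hR.tr_self))
      ((v.trC R).linst (.lapp (A := ctr R R) (f.trV R) (.topEq hR.tr_self))) := by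
  refine (Eqv.lolli_beta _ _).trans (.of_eq ?_)
  refine (Tm.linst_linst (v.trC R) (.lapp (A := ctr R R) (f.trV R) .svar) _).trans ?_
  exact congrArg (v.trC R).linst (Tm.lapp_linst (B := ctr R R) (f.trV R) .svar _)

variable {A B : VTy V W} {C D E : CTy V W}

theorem trTr_cpair (t : Tm Γ Δ (.comp C)) (u : Tm Γ Δ (.comp D)) :
    Eqv ((Tm.cpair t u).trTr hR)
      (.cpair (A := ctr R (ctr R C)) (B := ctr R (ctr R D)) (t.trTr hR) (u.trTr hR)) := by
  cases Δ with
  | none =>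
    refine (Eqv.lolli_beta _ _).trans (.of_eq ?_)
    exact congrArg₂ (Tm.cpair (A := ctr R (ctr R C)) (B := ctr R (ctr R D)))
      (Tm.lapp_linst (B := ctr R R) ((t.trV R).trV R) _ _)
      (Tm.lapp_linst (B := ctr R R) ((u.trV R).trV R) _ _)
  | some _ => exact .refl _

theorem trTr_clam (t : Tm (A :: Γ) Δ (.comp D)) :
    Eqv ((Tm.clam t).trTr hR)
      (.clam (A := vtr R (vtr R A)) (B := ctr R (ctr R D)) (t.trTr hR)) := by
  cases Δ with
  | none =>
    refine (Eqv.lolli_beta _ _).trans (.of_eq ?_)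
    refine (Tm.clam_linst (A := vtr R (vtr R A)) (B := ctr R (ctr R D)) _ _).trans ?_
    refine congrArg (Tm.clam (A := vtr R (vtr R A)) (B := ctr R (ctr R D))) ?_
    refine (Tm.lapp_linst (B := ctr R R) ((t.trV R).trV R) _ _).trans ?_
    rw [Tm.topEq_wk]
    rfl
  | some _ => exact .refl _

theorem trTr_top : Eqv ((Tm.top : Tm Γ none _).trTr hR) (.topEq hR.tr_self) :=
  Eqv.lolli_beta _ _

theorem trTr_bang (t : Tm Γ none A) :
    Eqv ((Tm.bang t).trTr hR)
      (.ten (A := vtr R (vtr R A)) (B := ctr R R) ((t.trV R).trV R) (.topEq hR.tr_self)) :=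
  (Eqv.lolli_beta _ _).trans (.of_eq (Tm.ten_linst ((t.trV R).trV R) _ _))

theorem trTr_cfst (t : Tm Γ Δ (.comp (.amp C D))) :
    Eqv ((Tm.cfst t).trTr hR)
      (.cfst (A := ctr R (ctr R C)) (B := ctr R (ctr R D)) (t.trTr hR)) := by
  cases Δ with
  | none => exact trTr_of_lapp hR (A := .amp C D) (t.trV R) (.inl .svar)
  | some _ => exact (t.trC R).trC_linst R (D := .plus (ctr R C) (ctr R D)) (.inl .svar)

theorem trTr_csnd (t : Tm Γ Δ (.comp (.amp C D))) :
    Eqv ((Tm.csnd t).trTr hR)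
      (.csnd (A := ctr R (ctr R C)) (B := ctr R (ctr R D)) (t.trTr hR)) := by
  cases Δ with
  | none => exact trTr_of_lapp hR (A := .amp C D) (t.trV R) (.inr .svar)
  | some _ => exact (t.trC R).trC_linst R (D := .plus (ctr R C) (ctr R D)) (.inr .svar)

theorem trTr_capp (s : Tm Γ Δ (.comp (.pow A D))) (t : Tm Γ none A) :
    Eqv ((Tm.capp s t).trTr hR)
      (.capp (A := vtr R (vtr R A)) (B := ctr R (ctr R D)) (s.trTr hR) ((t.trV R).trV R)) := by
  refine Eqv.trans ?_ (.of_eq (Tm.capp_linst (A := vtr R (vtr R A)) (B := ctr R (ctr R D))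
    .svar ((t.trV R).trV R) (s.trTr hR)))
  cases Δ with
  | none => exact trTr_of_lapp hR (A := .pow A D) (s.trV R) (.ten (t.trV R) .svar)
  | some _ =>
    exact (s.trC R).trC_linst R (D := .copow (vtr R A) (ctr R D)) (.ten (t.trV R) .svar)

theorem trTr_ilet (t : Tm Γ Δ (.comp .I)) (u : Tm Γ none (.comp C)) :
    Eqv ((Tm.ilet t u).trTr hR)
      (.lapp (A := ctr R R) (B := ctr R (ctr R C)) ((u.trV R).trV R) (t.trTr hR)) := by
  refine Eqv.trans ?_ (.of_eq (Tm.lapp_linst (B := ctr R R) (C := ctr R (ctr R C))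
    ((u.trV R).trV R) .svar (t.trTr hR)))
  cases Δ with
  | none => exact trTr_of_lapp hR (A := .I) (t.trV R) (.lapp (A := ctr R C) (u.trV R) .svar)
  | some _ =>
    exact (t.trC R).trC_linst R (D := R) (.lapp (A := ctr R C) (u.trV R) .svar)

theorem trTr_blet (t : Tm Γ Δ (.comp (.bang A))) (u : Tm (A :: Γ) none (.comp C)) :
    Eqv ((Tm.blet t u).trTr hR)
      (.tlet (A := vtr R (vtr R A)) (B := ctr R R) (t.trTr hR)
        (.lapp (A := ctr R R) (B := ctr R (ctr R C)) ((u.trV R).trV R) .svar)) := by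
  refine Eqv.trans ?_ (.of_eq (Tm.tlet_linst (A := vtr R (vtr R A)) (B := ctr R R)
    .svar (.lapp (A := ctr R R) (B := ctr R (ctr R C)) ((u.trV R).trV R) .svar) (t.trTr hR)))
  cases Δ with
  | none =>
    exact trTr_of_lapp hR (A := .bang A) (t.trV R)
      (.clam (.lapp (A := ctr R C) (u.trV R) .svar))
  | some _ =>
    exact (t.trC R).trC_linst R (D := .pow (vtr R A) R)
      (.clam (.lapp (A := ctr R C) (u.trV R) .svar))

theorem trTr_ten (t : Tm Γ none A) (u : Tm Γ Δ (.comp D)) :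
    Eqv ((Tm.ten t u).trTr hR)
      (.ten (A := vtr R (vtr R A)) (B := ctr R (ctr R D)) ((t.trV R).trV R) (u.trTr hR)) := by
  refine Eqv.trans ?_ (.of_eq (Tm.ten_linst (A := vtr R (vtr R A)) (B := ctr R (ctr R D))
    ((t.trV R).trV R) .svar (u.trTr hR)))
  cases Δ with
  | none => exact trTr_of_lapp hR (B := .copow A D) (u.trV R) (.capp .svar (t.trV R))
  | some _ => exact (u.trC R).trC_linst R (.capp .svar (t.trV R))

theorem trTr_tlet (s : Tm Γ Δ (.comp (.copow A D))) (t : Tm (A :: Γ) (some D) (.comp C)) :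
    Eqv ((Tm.tlet s t).trTr hR)
      (.tlet (A := vtr R (vtr R A)) (B := ctr R (ctr R D)) (s.trTr hR) ((t.trC R).trC R)) := by
  refine Eqv.trans ?_ (.of_eq (Tm.tlet_linst (A := vtr R (vtr R A)) (B := ctr R (ctr R D))
    .svar ((t.trC R).trC R) (s.trTr hR)))
  cases Δ with
  | none => exact trTr_of_lapp hR (A := .copow A D) (s.trV R) (.clam (t.trC R))
  | some _ => exact (s.trC R).trC_linst R (D := .pow (vtr R A) (ctr R D)) (.clam (t.trC R))

theorem trTr_image (t : Tm Γ Δ (.comp .zero)) :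
    Eqv ((Tm.image (A := C) t).trTr hR) (.image (t.trTr hR)) := by
  cases Δ with
  | none => exact trTr_of_lapp hR (A := .zero) (t.trV R) .cstar
  | some _ => exact (t.trC R).trC_linst R (D := .one) .cstar

theorem trTr_inl (t : Tm Γ Δ (.comp C)) :
    Eqv ((Tm.inl (B := D) t).trTr hR)
      (.inl (A := ctr R (ctr R C)) (B := ctr R (ctr R D)) (t.trTr hR)) := by
  cases Δ with
  | none => exact trTr_of_lapp hR (B := .plus C D) (t.trV R) (.cfst .svar)
  | some _ => exact (t.trC R).trC_linst R (.cfst (B := ctr R D) .svar)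

theorem trTr_inr (t : Tm Γ Δ (.comp D)) :
    Eqv ((Tm.inr (A := C) t).trTr hR)
      (.inr (A := ctr R (ctr R C)) (B := ctr R (ctr R D)) (t.trTr hR)) := by
  cases Δ with
  | none => exact trTr_of_lapp hR (B := .plus C D) (t.trV R) (.csnd .svar)
  | some _ => exact (t.trC R).trC_linst R (.csnd (A := ctr R C) .svar)

theorem trTr_cases (s : Tm Γ Δ (.comp (.plus C D))) (t : Tm Γ (some C) (.comp E))
    (u : Tm Γ (some D) (.comp E)) :
    Eqv ((Tm.cases s t u).trTr hR)
      (.cases (A := ctr R (ctr R C)) (B := ctr R (ctr R D)) (s.trTr hR)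
        ((t.trC R).trC R) ((u.trC R).trC R)) := by
  refine Eqv.trans ?_ (.of_eq (Tm.cases_linst (B := ctr R (ctr R C)) (C := ctr R (ctr R D))
    .svar ((t.trC R).trC R) ((u.trC R).trC R) (s.trTr hR)))
  cases Δ with
  | none => exact trTr_of_lapp hR (A := .plus C D) (s.trV R) (.cpair (t.trC R) (u.trC R))
  | some _ =>
    exact (s.trC R).trC_linst R (D := .amp (ctr R C) (ctr R D)) (.cpair (t.trC R) (u.trC R))

theorem trTr_lapp (s : Tm Γ none (.lolli C D)) (t : Tm Γ Δ (.comp C)) :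
    Eqv ((Tm.lapp s t).trTr hR)
      (.lapp (A := ctr R (ctr R C)) (B := ctr R (ctr R D)) ((s.trV R).trV R) (t.trTr hR)) := by
  refine Eqv.trans ?_ (.of_eq (Tm.lapp_linst (B := ctr R (ctr R C)) (C := ctr R (ctr R D))
    ((s.trV R).trV R) .svar (t.trTr hR)))
  cases Δ with
  | none => exact trTr_of_lapp hR (t.trV R) (.lapp (A := ctr R D) (s.trV R) .svar)
  | some _ => exact (t.trC R).trC_linst R (.lapp (A := ctr R D) (s.trV R) .svar)

end DoubleTranslation

/-! ## The involution property -/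

section Involution

variable {R : CTy V W} (hR : R.IsConstOrI) {Γ : Ctx V W} {Δ : Stoup V W}

/-- The substitution `[ϑ⁻¹[z]/k]` for the variable of a doubly translated stoup. -/
noncomputable def invSSub (Γ : Ctx V W) : (Δ : Stoup V W) →
    SSub Γ (Δ.map fun C => ctr R (ctr R C)) Δ
  | none => .empty
  | some C => .term (toCC hR C .svar)

theorem invSSub_wk (A : VTy V W) : (invSSub hR Γ Δ).wk A = invSSub hR (A :: Γ) Δ := by
  cases Δ with
  | none => rfl
  | some C => exact congrArg SSub.term (toCC_wk hR C A .svar)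

/-- The involution property for a term of an arbitrary type, in the form
`t°°[ϑ⁻¹Γ] = ϑ⁻¹(t)` or `t••[ϑ⁻¹Γ, ϑ⁻¹[z]/k] = ϑ⁻¹[t]`. -/
def Tm.Invol {Γ : Ctx V W} : {Δ : Stoup V W} → {A : VTy V W} → Tm Γ Δ A → Prop
  | none, A, t => Eqv (((t.trV R).trV R).sub (invSub hR Γ) .empty) (toVV hR A t)
  | some C, .comp D, t =>
    Eqv (((t.trC R).trC R).sub (invSub hR Γ) (.term (toCC hR C .svar))) (toCC hR D t)
  | some _, _, _ => True

/-- The involution property for a term of a computation type. -/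
def Tm.InvolC {C : CTy V W} (t : Tm Γ Δ (.comp C)) : Prop :=
  Eqv ((t.trTr hR).sub (invSub hR Γ) (invSSub hR Γ Δ)) (toCC hR C t)

theorem trTr_none_sub {C : CTy V W} (t : Tm Γ none (.comp C)) :
    (t.trTr hR).sub (invSub hR Γ) .empty =
      .lapp (A := ctr R R) (((t.trV R).trV R).sub (invSub hR Γ) .empty) (.topEq hR.tr_self) :=
  congrArg (Tm.lapp (A := ctr R R) _) (Tm.topEq_sub hR.tr_self _)

theorem Tm.Invol.involC {C : CTy V W} {t : Tm Γ Δ (.comp C)} (h : t.Invol hR) :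
    t.InvolC hR := by
  cases Δ with
  | none =>
    exact (Eqv.of_eq (trTr_none_sub hR t)).trans
      ((Eqv.lapp h (.refl _)).trans (lapp_toVV_comp_top hR t))
  | some D => exact h

theorem Tm.InvolC.invol {C : CTy V W} {t : Tm Γ Δ (.comp C)} (h : t.InvolC hR) :
    t.Invol hR := by
  cases Δ with
  | none =>
    exact Eqv.lolli_castC_ext hR.tr_self ((Eqv.of_eq (trTr_none_sub hR t).symm).trans
      (h.trans (lapp_toVV_comp_top hR t).symm))
  | some D => exact h

/-- The substitution `[ϑ(x)/x]` for the most recent variable. -/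
noncomputable def fromSub (A : VTy V W) (Γ : Ctx V W) :
    VSub (A :: Γ) (vtr R (vtr R A) :: Γ) :=
  .cons (fromVV hR A (.var .zero)) fun _ x => .var (.succ x)

theorem wk_sub_fromSub {A B : VTy V W} (t : Tm Γ none B) :
    (t.wk A).sub (fromSub hR A Γ) .empty = t.wk _ := by
  rw [fromSub, Tm.wk_sub_cons, Tm.wk, Tm.ren_eq_sub]
  rfl

theorem invSub_comp_fromSub (A : VTy V W) :
    ((invSub hR (A :: Γ)).comp (fromSub hR A Γ)).Eqv
      (Γ := vtr R (vtr R A) :: Ctx.tr R (Ctx.tr R Γ)) ((invSub hR Γ).lift (vtr R (vtr R A)))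
  | _, .zero => by
    refine (Eqv.of_eq (toVV_sub hR A _ _)).trans ?_
    exact toVV_fromVV hR A _
  | _, .succ x => .of_eq (wk_sub_fromSub hR _)

theorem invSSub_sub_fromSub (A : VTy V W) :
    (invSSub hR (A :: Γ) Δ).sub (fromSub hR A Γ) (.id _ Δ) = (invSSub hR Γ Δ).wk _ := by
  rw [invSSub_wk]
  cases Δ with
  | none => rfl
  | some C => exact congrArg SSub.term (toCC_sub hR C _ _ _)

theorem ren_lift_inst_fromVV {A B : VTy V W} (t : Tm (A :: Γ) Δ B) :
    (t.ren (Ren.lift (fun _ x => .succ x) A)).inst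
      (fromVV hR A (.var .zero : Tm (vtr R (vtr R A) :: Γ) none _)) =
      t.sub (fromSub hR A Γ) (.id _ Δ) := by
  rw [Tm.inst, Tm.ren_sub]
  congr 1
  funext _ x
  cases x <;> rfl

theorem invSub_cons_eq (A : VTy V W) :
    ((invSub hR Γ).lift (vtr R (vtr R A))).comp
      (.cons (toVV hR A (.var .zero)) fun _ x => .var (.succ x)) = invSub hR (A :: Γ) := by
  funext _ x
  cases x with
  | zero => rfl
  | succ x =>
    refine (Tm.wk_sub_cons _ _ _ _).trans ?_
    rw [invSub, Tm.wk, Tm.ren_eq_sub]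
    rfl

variable {A B : VTy V W} {C D E : CTy V W}

theorem Tm.Invol.var (x : Var Γ A) : (Tm.var x).Invol hR := by
  refine .of_eq ?_
  change invSub hR Γ _ ((x.tr R).tr R) = _
  induction x with
  | zero => rfl
  | succ x ih => exact (congrArg (Tm.wk _) ih).trans (toVV_wk hR _ _ _)

theorem Tm.Invol.lam {t : Tm (A :: Γ) none B} (h : t.Invol hR) : (Tm.lam t).Invol hR := by
  have h' := Eqv.sub h (fromSub hR A Γ) .empty
  refine Eqv.trans ?_ (toVV_arr hR _).symm
  refine Eqv.lam (Eqv.trans (Eqv.trans ?_ h') ?_)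
  · refine Eqv.trans ?_ (.of_eq (Tm.sub_sub _ _ _ _ _).symm)
    refine (Tm.sub_congr _ (invSub_comp_fromSub hR A) (.refl _)).symm
  · refine (Eqv.of_eq (toVV_sub hR B t _)).trans (Eqv.toVV hR B ?_)
    exact (Eqv.of_eq (ren_lift_inst_fromVV hR t).symm).trans (Eqv.arr_beta _ _).symm

theorem Tm.InvolC.clam {t : Tm (A :: Γ) Δ (.comp C)} (h : t.InvolC hR) :
    (Tm.clam t).InvolC hR := by
  have h' := Eqv.sub h (fromSub hR A Γ) (.id _ Δ)
  refine ((trTr_clam hR t).sub _ _).trans ?_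
  refine Eqv.trans ?_ (toCC_pow hR _).symm
  refine Eqv.clam (Eqv.trans (Eqv.trans ?_ h') ?_)
  · refine Eqv.trans ?_ (.of_eq (Tm.sub_sub _ _ _ _ _).symm)
    rw [invSSub_sub_fromSub]
    exact (Tm.sub_congr _ (invSub_comp_fromSub hR A) (.refl _)).symm
  · refine (Eqv.of_eq (toCC_sub hR C t _ _)).trans (Eqv.toCC hR C ?_)
    exact (Eqv.of_eq (ren_lift_inst_fromVV hR t).symm).trans (Eqv.pow_beta _ _).symm

theorem Tm.InvolC.cpair {t : Tm Γ Δ (.comp C)} {u : Tm Γ Δ (.comp D)} (ht : t.InvolC hR)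
    (hu : u.InvolC hR) : (Tm.cpair t u).InvolC hR :=
  ((trTr_cpair hR t u).sub _ _).trans ((Eqv.cpair
    (ht.trans (Eqv.toCC hR C (Eqv.cfst_beta t u).symm))
    (hu.trans (Eqv.toCC hR D (Eqv.csnd_beta t u).symm))).trans (toCC_amp hR _).symm)

theorem Tm.InvolC.cfst {t : Tm Γ Δ (.comp (.amp C D))} (h : t.InvolC hR) :
    (Tm.cfst t).InvolC hR :=
  ((trTr_cfst hR t).sub _ _).trans ((Eqv.cfst h).trans (cfst_toCC hR t))

theorem Tm.InvolC.csnd {t : Tm Γ Δ (.comp (.amp C D))} (h : t.InvolC hR) :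
    (Tm.csnd t).InvolC hR :=
  ((trTr_csnd hR t).sub _ _).trans ((Eqv.csnd h).trans (csnd_toCC hR t))

theorem Tm.InvolC.capp {s : Tm Γ Δ (.comp (.pow A D))} {t : Tm Γ none A} (hs : s.InvolC hR)
    (ht : t.Invol hR) : (Tm.capp s t).InvolC hR :=
  ((trTr_capp hR s t).sub _ _).trans ((Eqv.capp hs ht).trans ((capp_toCC hR s _).trans
    (Eqv.toCC hR D (.capp (.refl s) (fromVV_toVV hR A t)))))

theorem Tm.InvolC.top : (Tm.top : Tm Γ none _).InvolC hR :=
  ((trTr_top hR).sub _ _).trans ((Eqv.of_eq (Tm.topEq_sub _ _)).trans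
    ((Eqv.of_eq (Tm.topEq_eq_castC hR.tr_self)).trans (toCC_I hR .top).symm))

theorem toCC_ilet (t : Tm Γ Δ (.comp .I)) (u : Tm Γ none (.comp C)) :
    Eqv (toCC hR C (.ilet t u)) (.ilet t (toCC hR C u)) := by
  have h := Eqv.linst_ilet (toCC hR C .svar) t u
  rwa [toCC_linst, toCC_linst] at h

theorem toCC_blet (t : Tm Γ Δ (.comp (.bang A))) (u : Tm (A :: Γ) none (.comp C)) :
    Eqv (toCC hR C (.blet t u)) (.blet t (toCC hR C u)) := by
  have h := Eqv.linst_blet (toCC hR C .svar) t u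
  rwa [toCC_wk, toCC_linst, toCC_linst] at h

theorem toCC_tlet (t : Tm Γ Δ (.comp (.copow A D))) (u : Tm (A :: Γ) (some D) (.comp C)) :
    Eqv (toCC hR C (.tlet t u)) (.tlet t (toCC hR C u)) := by
  have h := Eqv.linst_tlet (toCC hR C .svar) t u
  rwa [toCC_wk, toCC_linst, toCC_linst] at h

theorem toCC_cases (s : Tm Γ Δ (.comp (.plus C D))) (t : Tm Γ (some C) (.comp E))
    (u : Tm Γ (some D) (.comp E)) :
    Eqv (toCC hR E (.cases s t u)) (.cases s (toCC hR E t) (toCC hR E u)) := by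
  have h := Eqv.linst_cases (toCC hR E .svar) s t u
  rwa [toCC_linst, toCC_linst, toCC_linst] at h

theorem Tm.InvolC.ilet {t : Tm Γ Δ (.comp .I)} {u : Tm Γ none (.comp C)} (ht : t.InvolC hR)
    (hu : u.Invol hR) : (Tm.ilet t u).InvolC hR :=
  ((trTr_ilet hR t u).sub _ _).trans ((Eqv.lapp hu ht).trans ((lapp_toVV_comp hR u _).trans
    ((Eqv.ilet ((Eqv.castC _ (toCC_I hR t)).trans (.of_eq (t.castC_castC _ _))) (.refl _)).trans
      (toCC_ilet hR t u).symm)))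

theorem Tm.InvolC.bang {t : Tm Γ none A} (h : t.Invol hR) : (Tm.bang t).InvolC hR :=
  ((trTr_bang hR t).sub _ _).trans ((Eqv.ten h (.of_eq (Tm.topEq_sub _ _))).trans
    (toCC_bang_bang hR t).symm)

/-- `let !x ⊗ y be (let !x be t in !a ⊗ b) in w` -/
theorem Eqv.tlet_blet_ten {A' : VTy V W} (t : Tm Γ Δ (.comp (.bang A)))
    (a : Tm (A :: Γ) none A') (b : Tm (A :: Γ) none (.comp D))
    (w : Tm (A' :: Γ) (some D) (.comp C)) :
    Eqv (.tlet (.blet t (.ten a b)) w)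
      (.blet t (w.sub (.cons a fun _ x => .var (.succ x)) (.term b))) := by
  have h := Eqv.linst_blet (.tlet .svar w) t (.ten a b)
  rw [Tm.tlet_linst] at h
  refine h.trans (.blet (.refl _) ?_)
  change Eqv ((Tm.tlet .svar (w.ren _)).linst _) _
  rw [Tm.tlet_linst]
  refine (Eqv.copow_beta _ _ _).trans (.of_eq ?_)
  rw [Tm.ren_sub]
  congr 1
  funext _ x
  cases x <;> rfl

theorem Eqv.tlet_tlet_ten {A' : VTy V W} {B' : CTy V W} (t : Tm Γ Δ (.comp (.copow A B')))
    (a : Tm (A :: Γ) none A') (b : Tm (A :: Γ) (some B') (.comp D))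
    (w : Tm (A' :: Γ) (some D) (.comp C)) :
    Eqv (.tlet (.tlet t (.ten a b)) w)
      (.tlet t (w.sub (.cons a fun _ x => .var (.succ x)) (.term b))) := by
  have h := Eqv.linst_tlet (.tlet .svar w) t (.ten a b)
  rw [Tm.tlet_linst] at h
  refine h.trans (.tlet (.refl _) ?_)
  change Eqv ((Tm.tlet .svar (w.ren _)).linst _) _
  rw [Tm.tlet_linst]
  refine (Eqv.copow_beta _ _ _).trans (.of_eq ?_)
  rw [Tm.ren_sub]
  congr 1
  funext _ x
  cases x <;> rfl

theorem Tm.InvolC.blet {t : Tm Γ Δ (.comp (.bang A))} {u : Tm (A :: Γ) none (.comp C)}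
    (ht : t.InvolC hR) (hu : u.InvolC hR) : (Tm.blet t u).InvolC hR := by
  refine ((trTr_blet hR t u).sub _ _).trans ?_
  refine (Eqv.tlet (ht.trans (toCC_bang hR t)) (.refl _)).trans ?_
  refine (Eqv.tlet_blet_ten _ _ _ _).trans ?_
  refine (Eqv.blet (.refl _) (Eqv.trans (.of_eq ?_) hu)).trans (toCC_blet hR t u).symm
  refine Eq.trans ?_ (trTr_none_sub hR u).symm
  refine congrArg (Tm.lapp (A := ctr R R) · _) ?_
  exact (Tm.sub_sub _ _ _ _ _).trans (by rw [invSub_cons_eq]; rfl)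

theorem Tm.InvolC.ten {t : Tm Γ none A} {u : Tm Γ Δ (.comp D)} (ht : t.Invol hR)
    (hu : u.InvolC hR) : (Tm.ten t u).InvolC hR :=
  ((trTr_ten hR t u).sub _ _).trans ((Eqv.ten ht hu).trans (toCC_ten hR t u).symm)

theorem Tm.InvolC.tlet {s : Tm Γ Δ (.comp (.copow A D))} {t : Tm (A :: Γ) (some D) (.comp C)}
    (hs : s.InvolC hR) (ht : t.Invol hR) : (Tm.tlet s t).InvolC hR := by
  refine ((trTr_tlet hR s t).sub _ _).trans ?_
  refine (Eqv.tlet (hs.trans (toCC_copow hR s)) (.refl _)).trans ?_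
  refine (Eqv.tlet_tlet_ten _ _ _ _).trans ?_
  refine (Eqv.tlet (.refl _) (Eqv.trans (.of_eq ?_) ht)).trans (toCC_tlet hR s t).symm
  exact (Tm.sub_sub _ _ _ _ _).trans (by rw [invSub_cons_eq]; rfl)

theorem Tm.InvolC.image {t : Tm Γ Δ (.comp .zero)} (h : t.InvolC hR) :
    (Tm.image (A := C) t).InvolC hR := by
  refine ((trTr_image hR t).sub _ _).trans ((Eqv.image (h.trans (toCC_zero hR t))).trans ?_)
  have h := Eqv.linst_image (toCC hR C .svar) t
  rw [toCC_linst] at h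
  exact h.symm

theorem Tm.InvolC.inl {t : Tm Γ Δ (.comp C)} (h : t.InvolC hR) :
    (Tm.inl (B := D) t).InvolC hR :=
  ((trTr_inl hR t).sub _ _).trans ((Eqv.inl h).trans (toCC_inl hR t).symm)

theorem Tm.InvolC.inr {t : Tm Γ Δ (.comp D)} (h : t.InvolC hR) :
    (Tm.inr (A := C) t).InvolC hR :=
  ((trTr_inr hR t).sub _ _).trans ((Eqv.inr h).trans (toCC_inr hR t).symm)

theorem Eqv.cases_cases_inl_inr {B C B' C' : CTy V W} (s : Tm Γ Δ (.comp (.plus B C)))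
    (a : Tm Γ (some B) (.comp B')) (b : Tm Γ (some C) (.comp C'))
    (t : Tm Γ (some B') (.comp E)) (u : Tm Γ (some C') (.comp E)) :
    Eqv (.cases (.cases s (.inl a) (.inr b)) t u) (.cases s (t.linst a) (u.linst b)) := by
  have h := Eqv.linst_cases (.cases .svar t u) s (.inl a) (.inr b)
  rw [Tm.cases_linst, Tm.cases_linst, Tm.cases_linst] at h
  exact h.trans (.cases (.refl _) (.inl_beta _ _ _) (.inr_beta _ _ _))

theorem Tm.InvolC.cases {s : Tm Γ Δ (.comp (.plus C D))} {t : Tm Γ (some C) (.comp E)}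
    {u : Tm Γ (some D) (.comp E)} (hs : s.InvolC hR) (ht : t.Invol hR) (hu : u.Invol hR) :
    (Tm.cases s t u).InvolC hR := by
  refine ((trTr_cases hR s t u).sub _ _).trans ?_
  refine (Eqv.cases (hs.trans (toCC_plus hR s)) (.refl _) (.refl _)).trans ?_
  refine (Eqv.cases_cases_inl_inr _ _ _ _ _).trans (Eqv.trans ?_ (toCC_cases hR s t u).symm)
  exact .cases (.refl _) ((Eqv.of_eq (Tm.sub_linst _ _ _)).trans ht)
    ((Eqv.of_eq (Tm.sub_linst _ _ _)).trans hu)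

theorem Tm.Invol.llam {t : Tm Γ (some C) (.comp D)} (h : t.Invol hR) :
    (Tm.llam t).Invol hR := by
  have h' := Eqv.linst h (.refl (fromCC hR C .svar))
  refine Eqv.trans ?_ (toVV_lolli hR _).symm
  refine Eqv.llam (Eqv.trans (Eqv.trans ?_ h') ?_)
  · refine Eqv.trans ?_ (.of_eq (Tm.sub_sub _ _ _ _ _).symm)
    rw [VSub.comp_id]
    refine Tm.sub_congr _ (.refl _) (.term (Eqv.symm ?_))
    exact (Eqv.of_eq (toCC_linst hR C _ .svar _)).trans (toCC_fromCC hR C _)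
  · refine (Eqv.of_eq (toCC_linst hR D C t _)).trans (Eqv.toCC hR D (Eqv.lolli_beta _ _).symm)

theorem Tm.InvolC.lapp {s : Tm Γ none (.lolli C D)} {t : Tm Γ Δ (.comp C)} (hs : s.Invol hR)
    (ht : t.InvolC hR) : (Tm.lapp s t).InvolC hR :=
  ((trTr_lapp hR s t).sub _ _).trans ((Eqv.lapp hs ht).trans ((lapp_toVV hR s _).trans
    (Eqv.toCC hR D (.lapp (.refl s) (fromCC_toCC hR C t)))))

theorem Tm.invol {Γ : Ctx V W} {Δ : Stoup V W} {A : VTy V W} (t : Tm Γ Δ A) : t.Invol hR := by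
  induction t with
  | var x => exact .var hR x
  | star => exact (Eqv.one_eta (V := V) (W := W) _).symm
  | pair t u iht ihu =>
    exact (Eqv.pair (iht.trans (Eqv.toVV hR _ (Eqv.fst_beta t u).symm))
      (ihu.trans (Eqv.toVV hR _ (Eqv.snd_beta t u).symm))).trans (toVV_prod hR _).symm
  | fst t ih => exact (Eqv.fst ih).trans (fst_toVV hR t)
  | snd t ih => exact (Eqv.snd ih).trans (snd_toVV hR t)
  | lam t ih => exact ih.lam hR
  | app s t ihs iht =>
    exact (Eqv.app ihs iht).trans ((app_toVV hR s _).trans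
      (Eqv.toVV hR _ (.app (.refl s) (fromVV_toVV hR _ t))))
  | svar => exact .refl _
  | cstar => exact Tm.InvolC.invol hR ((Eqv.cone_eta (V := V) (W := W) _).trans
      (Eqv.cone_eta (V := V) (W := W) _).symm)
  | cpair t u iht ihu => exact ((iht.involC hR).cpair hR (ihu.involC hR)).invol hR
  | cfst t ih => exact ((ih.involC hR).cfst hR).invol hR
  | csnd t ih => exact ((ih.involC hR).csnd hR).invol hR
  | clam t ih => exact ((ih.involC hR).clam hR).invol hR
  | capp s t ihs iht => exact ((ihs.involC hR).capp hR iht).invol hR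
  | top => exact (Tm.InvolC.top hR).invol hR
  | ilet t u iht ihu => exact ((iht.involC hR).ilet hR ihu).invol hR
  | bang t ih => exact (Tm.InvolC.bang hR ih).invol hR
  | blet t u iht ihu => exact ((iht.involC hR).blet hR (ihu.involC hR)).invol hR
  | ten t u iht ihu => exact (Tm.InvolC.ten hR iht (ihu.involC hR)).invol hR
  | tlet s t ihs iht => exact ((ihs.involC hR).tlet hR iht).invol hR
  | image t ih => exact ((ih.involC hR).image hR).invol hR
  | inl t ih => exact ((ih.involC hR).inl hR).invol hR
  | inr t ih => exact ((ih.involC hR).inr hR).invol hR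
  | cases s t u ihs iht ihu => exact ((ihs.involC hR).cases hR iht ihu).invol hR
  | llam t ih => exact ih.llam hR
  | lapp s t ihs iht => exact (Tm.InvolC.lapp hR ihs (iht.involC hR)).invol hR

end Involution
end EEC

theorem mainTheorem1 {V : Type*} {W : Type*} (R : EEC.CTy V W) (hR : R.IsConstOrI) :
    (∀ A : EEC.VTy V W, EEC.IsVIso (EEC.viso hR A) (EEC.visoInv hR A)) ∧
    (∀ A : EEC.CTy V W, EEC.IsCIso (EEC.ciso hR A) (EEC.cisoInv hR A)) ∧
    (∀ (Γ : EEC.Ctx V W) (A : EEC.VTy V W) (t : EEC.Tm Γ none A),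
      EEC.Eqv t
        (.app ((EEC.viso hR A).closed Γ) (((t.trV R).trV R).sub (EEC.invSub hR Γ) .empty))) ∧
    (∀ (Γ : EEC.Ctx V W) (A B : EEC.CTy V W) (t : EEC.Tm Γ (some A) (.comp B)),
      EEC.Eqv t
        (.lapp ((EEC.ciso hR B).closed Γ)
          (((t.trC R).trC R).sub (EEC.invSub hR Γ)
            (.term (.lapp ((EEC.cisoInv hR A).closed Γ) .svar))))) :=
  ⟨EEC.isVIso_viso hR, EEC.isCIso_ciso hR,
    fun _ A t => (EEC.fromVV_toVV hR A t).symm.trans (EEC.Eqv.fromVV hR A (t.invol hR).symm),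
    fun _ _ B t => (EEC.fromCC_toCC hR B t).symm.trans (EEC.Eqv.fromCC hR B (t.invol hR).symm)⟩
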